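/- Let $n\in\{3,4\}$, let $U\subseteq\mathbb R^2$ be open, and let $F=F(x,y)$ be a real function of class $C^{n-1}$ on $U$. For functions $y=y(x)$ of class $C^n$ with graph in $U$, let $\Omega_F=\frac{d}{dx}+F(x,y)$, $\Omega_F^0[y]=y$ and $\Omega_F^{k}[y]=\Omega_F\big(\Omega_F^{k-1}[y]\big)=\frac{d}{dx}\Omega_F^{k-1}[y]+F(x,y)\,\Omega_F^{k-1}[y]$ (with the same $y$ inside $F$ at each step), and consider the $n$-th order equation $\Omega_F^n[y]=0$. Fix a smoothness class $C^r$ with $n\le r\le\infty$ or $r=\omega$. For an open set $V\subseteq U$, the equation is called linearizable on $V$ if there is an invertible point transformation $z=\rho(x,y)$, $w=\psi(x,y)$ on $V$ (of class $C^r$, injective on $V$, with $\rho_x\psi_y-\rho_y\psi_x\ne0$) that carries it to a linear equation $w^{(n)}+\sum_{k<n}a_k(z)w^{(k)}+b(z)=0$ with coefficients continuous on $\rho(V)$; that is, the prolonged transformation maps the one equation onto the other, as hypersurfaces in the jet space, at all $n$-jets over $V$ where $\rho_x+\rho_y y'\neq0$. It is linearizable near a point if it is linearizable on some neighbourhood of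 that point. It is linear on $V$ if $\Omega_F^n[y]=y^{(n)}+\sum_{k<n}a_k(x)y^{(k)}+b(x)$ identically over $V$, for some continuous functions $a_k$, $b$ of $x$. 1. For every $p\in U$, the equation is linearizable near $p$ if and only if $F=F(x)$ in a neighbourhood of $p$ (that is, $F$ does not depend on $y$ there), and if and only if $F_y=0$ in a neighbourhood of $p$. In that case the equation is already linear near $p$. Hence an equation that is not linear in any neighbourhood of $p$ is not linearizable near $p$. 2. The equation is linearizable near every point of $U$ if and only if $F_y=0$ on $U$. 3. If, moreover, every set $\{y:(x,y)\in U\}$ is connected or empty (for instance, if $U$ is a rectangle), then the equation is linearizable on $U$ by a single point transformation if and only if $F=F(x)$ on $U$. In that case the equation is already linear on $U$. Hence, if the equation is not linear on $U$, it is not linearizable on $U$. -/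

import Mathlib

open Set Filter Topology

noncomputable section

/-- The operator `Ω = d/dx + F(x, y)` along the function `y = y(x)`, applied to `g = g(x)`. -/
def Omega (F : ℝ × ℝ → ℝ) (y g : ℝ → ℝ) : ℝ → ℝ :=
  fun x => deriv g x + F (x, y x) * g x

/-- The left-hand side `Ω_F^n[y]` of the `n`-th equation of the Riccati and Abel chain: the
`n`-fold iterate of `d/dx + F(x, y)` applied to `y`. -/
def chainExpr (F : ℝ × ℝ → ℝ) (n : ℕ) (y : ℝ → ℝ) : ℝ → ℝ :=
  (Omega F y)^[n] y

/-- The left-hand side `w⁽ⁿ⁾ + ∑_{k<n} a_k(z) w⁽ᵏ⁾ + b(z)` of a linear `n`-th order equation. -/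
def linearExpr (n : ℕ) (a : ℕ → ℝ → ℝ) (b : ℝ → ℝ) (w : ℝ → ℝ) : ℝ → ℝ :=
  fun z => iteratedDeriv n w z + ∑ k ∈ Finset.range n, a k z * iteratedDeriv k w z + b z

/-- The partial derivative `∂g/∂x` of `g = g(x, y)`. -/
def partialX (g : ℝ × ℝ → ℝ) (p : ℝ × ℝ) : ℝ := deriv (fun x => g (x, p.2)) p.1

/-- The partial derivative `∂g/∂y` of `g = g(x, y)`. -/
def partialY (g : ℝ × ℝ → ℝ) (p : ℝ × ℝ) : ℝ := deriv (fun y => g (p.1, y)) p.2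

/-- `z = ρ(x, y)`, `w = ψ(x, y)` is an invertible point transformation of class `C^r` on the open
set `V` of the `(x, y)`-plane: a `C^r` diffeomorphism of `V` onto its (open) image. -/
structure IsPointTransformationOn (r : WithTop ℕ∞) (ρ ψ : ℝ × ℝ → ℝ) (V : Set (ℝ × ℝ)) :
    Prop where
  contDiffOn_fst : ContDiffOn ℝ r ρ V
  contDiffOn_snd : ContDiffOn ℝ r ψ V
  injOn : InjOn (fun p => (ρ p, ψ p)) V
  jacobian_ne_zero : ∀ p ∈ V,
    partialX ρ p * partialY ψ p - partialY ρ p * partialX ψ p ≠ 0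

/-- The point transformation `z = ρ(x, y)`, `w = ψ(x, y)` carries the equation `Ω_F^n[y] = 0` over
`V` to the linear equation with coefficients `a`, `b`: whenever `y` is a function of class `C^n`
near `x₀` with `(x₀, y(x₀)) ∈ V`, whose graph is mapped near that point to the graph of a function
`w = w(z)` (which requires `d/dx ρ(x, y(x)) ≠ 0` at `x₀`), the first equation holds for `y` at `x₀`
if and only if the second one holds for `w` at the image point. Since every `n`-jet is the jet of
some function, this says that the prolonged transformation takes the one equation, as a
hypersurface in jet space, to the other. -/
def CarriesToLinearOn (n : ℕ) (F ρ ψ : ℝ × ℝ → ℝ) (a : ℕ → ℝ → ℝ) (b : ℝ → ℝ)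
    (V : Set (ℝ × ℝ)) : Prop :=
  ∀ (x₀ : ℝ) (y w : ℝ → ℝ),
    ContDiffAt ℝ n y x₀ → (x₀, y x₀) ∈ V →
    deriv (fun x => ρ (x, y x)) x₀ ≠ 0 →
    ContDiffAt ℝ n w (ρ (x₀, y x₀)) →
    (∀ᶠ x in 𝓝 x₀, w (ρ (x, y x)) = ψ (x, y x)) →
    (chainExpr F n y x₀ = 0 ↔ linearExpr n a b w (ρ (x₀, y x₀)) = 0)

/-- The equation `Ω_F^n[y] = 0` over `V` is linearizable by one point transformation of class `C^r`
defined on `V`: it is carried to a linear `n`-th order equation with continuous coefficients. -/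
def LinearizableOn (r : WithTop ℕ∞) (n : ℕ) (F : ℝ × ℝ → ℝ) (V : Set (ℝ × ℝ)) : Prop :=
  ∃ (ρ ψ : ℝ × ℝ → ℝ) (a : ℕ → ℝ → ℝ) (b : ℝ → ℝ),
    IsPointTransformationOn r ρ ψ V ∧
    (∀ k < n, ContinuousOn (a k) (ρ '' V)) ∧ ContinuousOn b (ρ '' V) ∧
    CarriesToLinearOn n F ρ ψ a b V

/-- The equation `Ω_F^n[y] = 0` is linearizable by a point transformation defined in some
neighbourhood of the point `p`. -/
def LinearizableNear (r : WithTop ℕ∞) (n : ℕ) (F : ℝ × ℝ → ℝ) (p : ℝ × ℝ) : Prop :=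
  ∃ V : Set (ℝ × ℝ), IsOpen V ∧ p ∈ V ∧ LinearizableOn r n F V

/-- The equation `Ω_F^n[y] = 0` over `V` is, as it stands, a linear `n`-th order equation for
`y = y(x)`, with continuous coefficients. -/
def IsLinearOn (n : ℕ) (F : ℝ × ℝ → ℝ) (V : Set (ℝ × ℝ)) : Prop :=
  ∃ (a : ℕ → ℝ → ℝ) (b : ℝ → ℝ),
    (∀ k < n, ContinuousOn (a k) (Prod.fst '' V)) ∧ ContinuousOn b (Prod.fst '' V) ∧
    ∀ (x₀ : ℝ) (y : ℝ → ℝ), ContDiffAt ℝ n y x₀ → (x₀, y x₀) ∈ V →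
      chainExpr F n y x₀ = linearExpr n a b y x₀

/-- The equation `Ω_F^n[y] = 0` is linear in some neighbourhood of the point `p`. -/
def IsLinearNear (n : ℕ) (F : ℝ × ℝ → ℝ) (p : ℝ × ℝ) : Prop :=
  ∃ V : Set (ℝ × ℝ), IsOpen V ∧ p ∈ V ∧ IsLinearOn n F V

end

/-!
If `F = F(x)`, then `Ω_F^n[y]` is visibly linear in `y`, and the identity transformation linearizes
the equation. The substance is the converse: an equation `Ω_F^n[y] = 0` with `n = 3` or `n = 4` that
is carried to a linear one by a point transformation `z = ρ(x, y)`, `w = ψ(x, y)` has `F_y = 0`.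

Write `f(x) = F(x, y(x))`. Then `Ω³[y] = y''' + 3 f y'' + …` and `Ω⁴[y] = y'''' + 4 f y''' + …`, and
in jet coordinates (`exists_chainExpr_three_jet`, `exists_chainExpr_four_jet`) these are affine in
the highest derivatives, with few mixed terms. All conditions are extracted pointwise, by testing the
hypothesis on polynomial curves with a prescribed jet and taking finite differences in the jet.

* The transformed equation contains `y''²` (for `n = 3`) or `y'' y'''` (for `n = 4`) with coefficient
  a nonzero multiple of `ρ_y` times the Jacobian; the given equation contains no such term. Hence
  `ρ_y = 0` (`eq_zero_of_jets_three`, `eq_zero_of_jets_four`), and `z` is locally a function of `x`.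
* The transformed equation then contains `y' y''`, respectively `y' y'''`, with coefficient a multiple
  of `ψ_yy`. Hence `ψ_yy = 0` (`eq_zero_of_fibred_jets_three`, `eq_zero_of_fibred_jets_four`), and
  `w` is locally affine in `y`.
* Consequently the superposition principle of the linear equation pulls back: midpoints of solution
  jets over the same `x` are solution jets (`CarriesToLinearOn.chainExpr_midpoint`). So the equation
  is affine in the jet of `y`. For `n = 3` the `y'²`-coefficient gives `3 F_y + y F_yy = 0`, and the
  `y''`-coefficient `3 F + y F_y` is constant in `y`, which gives `4 F_y + y F_yy = 0`. For `n = 4`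
  the `y' y''`-coefficient gives `10 F_y + 3 y F_yy = 0`, and the `y'''`-coefficient `4 F + y F_y`
  gives `5 F_y + y F_yy = 0`. In both cases `F_y = 0`.

Finally `F_y = 0` makes `F` a function of `x` on boxes, and on any open set with connected vertical
sections.
-/

/-! ### The chain and composition of jets -/

theorem ContDiffAt.eventually_hasDerivAt_iteratedDeriv {y : ℝ → ℝ} {x₀ : ℝ} {n k : ℕ}
    (hy : ContDiffAt ℝ n y x₀) (hk : k < n) :
    ∀ᶠ x in 𝓝 x₀, HasDerivAt (iteratedDeriv k y) (iteratedDeriv (k + 1) y x) x := by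
  filter_upwards [hy.eventually (by simp)] with x hx
  rw [iteratedDeriv_succ, hasDerivAt_deriv_iff]
  have h := ContDiffAt.differentiableAt_iteratedFDeriv (m := k) hx (by exact_mod_cast hk)
  rw [iteratedDeriv_eq_equiv_comp]
  exact (LinearIsometryEquiv.differentiable _).differentiableAt.comp x h

theorem iteratedDeriv_succ_of_eventually_hasDerivAt {h h' : ℝ → ℝ} {x₀ : ℝ}
    (H : ∀ᶠ x in 𝓝 x₀, HasDerivAt h (h' x) x) (k : ℕ) :
    iteratedDeriv (k + 1) h x₀ = iteratedDeriv k h' x₀ := by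
  rw [iteratedDeriv_succ']
  exact Filter.EventuallyEq.iteratedDeriv_eq k (H.mono fun x hx => hx.deriv)

/-- If `g` agrees near `x₀` with an explicit function `G` whose derivative `G'` is known, then
`Ω g` is `G' + F G` near `x₀`. This is how the iterates `Ω^k[y]` are unfolded one at a time. -/
theorem Omega_eq_of_eventually {F : ℝ × ℝ → ℝ} {y g G G' : ℝ → ℝ} {x₀ : ℝ}
    (h : ∀ᶠ x in 𝓝 x₀, g x = G x) (hG : ∀ᶠ x in 𝓝 x₀, HasDerivAt G (G' x) x) :
    ∀ᶠ x in 𝓝 x₀, Omega F y g x = G' x + F (x, y x) * G x := by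
  filter_upwards [h.eventually_nhds, hG] with x hx hGx
  have : g =ᶠ[𝓝 x] G := hx
  rw [Omega, this.deriv_eq, hGx.deriv, this.eq_of_nhds]

/-- `Ω²[y]` in terms of the derivatives of `y` and of `f(x) = F(x, y(x))`. The formula is needed in a
neighbourhood because the next iterate differentiates it; `f` may be any function that agrees with
`F` along the curve, so that the formula serves both for general `F` and for `F = f(x)`. -/
theorem eventually_iterate_Omega_two {F : ℝ × ℝ → ℝ} {y f : ℝ → ℝ} {x₀ : ℝ}
    (hFf : ∀ᶠ x in 𝓝 x₀, F (x, y x) = f x)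
    (hf : ContDiffAt ℝ 2 f x₀) (hy : ContDiffAt ℝ 3 y x₀) :
    ∀ᶠ x in 𝓝 x₀, (Omega F y)^[2] y x = iteratedDeriv 2 y x + 2 * f x * iteratedDeriv 1 y x
      + (iteratedDeriv 1 f x + f x ^ 2) * y x := by
  have f0 := hf.eventually_hasDerivAt_iteratedDeriv (k := 0) (by norm_num)
  have y0 := hy.eventually_hasDerivAt_iteratedDeriv (k := 0) (by norm_num)
  have y1 := hy.eventually_hasDerivAt_iteratedDeriv (k := 1) (by norm_num)
  simp only [iteratedDeriv_zero, zero_add, Nat.reduceAdd] at f0 y0 y1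
  have h1 := Omega_eq_of_eventually (F := F) (y := y) (g := y) (.of_forall fun _ => rfl) y0
  have h1' : ∀ᶠ x in 𝓝 x₀, Omega F y y x = iteratedDeriv 1 y x + f x * y x := by
    filter_upwards [h1, hFf] with x hx hx'
    rw [hx, hx']
  have h2 := Omega_eq_of_eventually (F := F) (y := y)
    (G' := fun x => iteratedDeriv 2 y x + (iteratedDeriv 1 f x * y x + f x * iteratedDeriv 1 y x))
    h1' (by
      filter_upwards [f0, y0, y1] with x f0 y0 y1
      exact y1.add (f0.mul y0))
  filter_upwards [h2, hFf] with x h2 hx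
  simp only [Function.iterate_succ_apply', Function.iterate_zero, id]
  rw [h2, hx]
  ring

theorem eventually_chainExpr_three {F : ℝ × ℝ → ℝ} {y f : ℝ → ℝ} {x₀ : ℝ}
    (hFf : ∀ᶠ x in 𝓝 x₀, F (x, y x) = f x)
    (hf : ContDiffAt ℝ 2 f x₀) (hy : ContDiffAt ℝ 3 y x₀) :
    ∀ᶠ x in 𝓝 x₀, chainExpr F 3 y x = iteratedDeriv 3 y x + 3 * f x * iteratedDeriv 2 y x
      + 3 * (iteratedDeriv 1 f x + f x ^ 2) * iteratedDeriv 1 y x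
      + (iteratedDeriv 2 f x + 3 * f x * iteratedDeriv 1 f x + f x ^ 3) * y x := by
  have f0 := hf.eventually_hasDerivAt_iteratedDeriv (k := 0) (by norm_num)
  have f1 := hf.eventually_hasDerivAt_iteratedDeriv (k := 1) (by norm_num)
  have y0 := hy.eventually_hasDerivAt_iteratedDeriv (k := 0) (by norm_num)
  have y1 := hy.eventually_hasDerivAt_iteratedDeriv (k := 1) (by norm_num)
  have y2 := hy.eventually_hasDerivAt_iteratedDeriv (k := 2) (by norm_num)
  simp only [iteratedDeriv_zero, zero_add, Nat.reduceAdd] at f0 f1 y0 y1 y2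
  have h := Omega_eq_of_eventually (F := F) (y := y) (eventually_iterate_Omega_two hFf hf hy)
    (by
      filter_upwards [f0, f1, y0, y1, y2] with x f0 f1 y0 y1 y2
      exact (y2.add ((f0.const_mul 2).mul y1)).add ((f1.add (f0.pow 2)).mul y0))
  filter_upwards [h, hFf] with x h hx
  rw [chainExpr, Function.iterate_succ_apply', h, hx]
  simp only [Pi.add_apply, Pi.pow_apply]
  push_cast
  ring

theorem chainExpr_three {F : ℝ × ℝ → ℝ} {y f : ℝ → ℝ} {x₀ : ℝ}
    (hFf : ∀ᶠ x in 𝓝 x₀, F (x, y x) = f x)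
    (hf : ContDiffAt ℝ 2 f x₀) (hy : ContDiffAt ℝ 3 y x₀) :
    chainExpr F 3 y x₀ = iteratedDeriv 3 y x₀ + 3 * f x₀ * iteratedDeriv 2 y x₀
      + 3 * (iteratedDeriv 1 f x₀ + f x₀ ^ 2) * iteratedDeriv 1 y x₀
      + (iteratedDeriv 2 f x₀ + 3 * f x₀ * iteratedDeriv 1 f x₀ + f x₀ ^ 3) * y x₀ :=
  (eventually_chainExpr_three hFf hf hy).self_of_nhds

theorem chainExpr_four {F : ℝ × ℝ → ℝ} {y f : ℝ → ℝ} {x₀ : ℝ}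
    (hFf : ∀ᶠ x in 𝓝 x₀, F (x, y x) = f x)
    (hf : ContDiffAt ℝ 3 f x₀) (hy : ContDiffAt ℝ 4 y x₀) :
    chainExpr F 4 y x₀ = iteratedDeriv 4 y x₀ + 4 * f x₀ * iteratedDeriv 3 y x₀
      + 6 * (iteratedDeriv 1 f x₀ + f x₀ ^ 2) * iteratedDeriv 2 y x₀
      + 4 * (iteratedDeriv 2 f x₀ + 3 * f x₀ * iteratedDeriv 1 f x₀ + f x₀ ^ 3)
        * iteratedDeriv 1 y x₀
      + (iteratedDeriv 3 f x₀ + 4 * f x₀ * iteratedDeriv 2 f x₀ + 3 * iteratedDeriv 1 f x₀ ^ 2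
        + 6 * f x₀ ^ 2 * iteratedDeriv 1 f x₀ + f x₀ ^ 4) * y x₀ := by
  have f0 := hf.eventually_hasDerivAt_iteratedDeriv (k := 0) (by norm_num)
  have f1 := hf.eventually_hasDerivAt_iteratedDeriv (k := 1) (by norm_num)
  have f2 := hf.eventually_hasDerivAt_iteratedDeriv (k := 2) (by norm_num)
  have y0 := hy.eventually_hasDerivAt_iteratedDeriv (k := 0) (by norm_num)
  have y1 := hy.eventually_hasDerivAt_iteratedDeriv (k := 1) (by norm_num)
  have y2 := hy.eventually_hasDerivAt_iteratedDeriv (k := 2) (by norm_num)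
  have y3 := hy.eventually_hasDerivAt_iteratedDeriv (k := 3) (by norm_num)
  simp only [iteratedDeriv_zero, zero_add, Nat.reduceAdd] at f0 f1 f2 y0 y1 y2 y3
  have h := Omega_eq_of_eventually (F := F) (y := y) (eventually_chainExpr_three hFf
      (hf.of_le (by norm_num)) (hy.of_le (by norm_num)))
    (by
      filter_upwards [f0, f1, f2, y0, y1, y2, y3] with x f0 f1 f2 y0 y1 y2 y3
      exact ((y3.add ((f0.const_mul 3).mul y2)).add
        (((f1.add (f0.pow 2)).const_mul 3).mul y1)).add
        (((f2.add ((f0.const_mul 3).mul f1)).add (f0.pow 3)).mul y0))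
  rw [chainExpr, Function.iterate_succ_apply', ← chainExpr, h.self_of_nhds, hFf.self_of_nhds]
  simp only [Pi.add_apply, Pi.mul_apply, Pi.pow_apply]
  push_cast
  ring

/-- Faà di Bruno's formulas up to order three for `W = w ∘ Z`, near a point. -/
theorem eventually_iteratedDeriv_comp {w Z W : ℝ → ℝ} {x₀ : ℝ}
    (hw : ContDiffAt ℝ 3 w (Z x₀)) (hZ : ContDiffAt ℝ 3 Z x₀)
    (hW : ∀ᶠ x in 𝓝 x₀, w (Z x) = W x) :
    ∀ᶠ x in 𝓝 x₀,
      iteratedDeriv 1 W x = iteratedDeriv 1 w (Z x) * iteratedDeriv 1 Z x ∧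
      iteratedDeriv 2 W x = iteratedDeriv 2 w (Z x) * iteratedDeriv 1 Z x ^ 2
        + iteratedDeriv 1 w (Z x) * iteratedDeriv 2 Z x ∧
      iteratedDeriv 3 W x = iteratedDeriv 3 w (Z x) * iteratedDeriv 1 Z x ^ 3
        + 3 * iteratedDeriv 2 w (Z x) * iteratedDeriv 1 Z x * iteratedDeriv 2 Z x
        + iteratedDeriv 1 w (Z x) * iteratedDeriv 3 Z x := by
  filter_upwards [hZ.continuousAt.eventually (hw.eventually (by simp)), hZ.eventually (by simp),
    hW.eventually_nhds] with x hw hZ hW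
  have hW : W =ᶠ[𝓝 x] w ∘ Z := by
    filter_upwards [hW] with t ht using ht.symm
  rw [hW.iteratedDeriv_eq 1, hW.iteratedDeriv_eq 2, hW.iteratedDeriv_eq 3,
    iteratedDeriv_comp_two (hw.of_le (by norm_num)) (hZ.of_le (by norm_num)),
    iteratedDeriv_comp_three hw hZ]
  simp only [iteratedDeriv_one]
  refine ⟨deriv_comp x (hw.differentiableAt (by norm_num)) (hZ.differentiableAt (by norm_num)),
    ?_, ?_⟩
  · trivial
  · ring

/-- Faà di Bruno's formula of order four for `W = w ∘ Z`. -/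
theorem iteratedDeriv_four_comp {w Z W : ℝ → ℝ} {x₀ : ℝ}
    (hw : ContDiffAt ℝ 4 w (Z x₀)) (hZ : ContDiffAt ℝ 4 Z x₀)
    (hW : ∀ᶠ x in 𝓝 x₀, w (Z x) = W x) :
    iteratedDeriv 4 W x₀ = iteratedDeriv 4 w (Z x₀) * iteratedDeriv 1 Z x₀ ^ 4
      + 6 * iteratedDeriv 3 w (Z x₀) * iteratedDeriv 1 Z x₀ ^ 2 * iteratedDeriv 2 Z x₀
      + iteratedDeriv 2 w (Z x₀) * (3 * iteratedDeriv 2 Z x₀ ^ 2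
        + 4 * iteratedDeriv 1 Z x₀ * iteratedDeriv 3 Z x₀)
      + iteratedDeriv 1 w (Z x₀) * iteratedDeriv 4 Z x₀ := by
  have h := eventually_iteratedDeriv_comp (hw.of_le (by norm_num)) (hZ.of_le (by norm_num)) hW
  have w1 := (hw.eventually_hasDerivAt_iteratedDeriv (k := 1) (by norm_num)).self_of_nhds
  have w2 := (hw.eventually_hasDerivAt_iteratedDeriv (k := 2) (by norm_num)).self_of_nhds
  have w3 := (hw.eventually_hasDerivAt_iteratedDeriv (k := 3) (by norm_num)).self_of_nhds
  have z0 := (hZ.eventually_hasDerivAt_iteratedDeriv (k := 0) (by norm_num)).self_of_nhds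
  have z1 := (hZ.eventually_hasDerivAt_iteratedDeriv (k := 1) (by norm_num)).self_of_nhds
  have z2 := (hZ.eventually_hasDerivAt_iteratedDeriv (k := 2) (by norm_num)).self_of_nhds
  have z3 := (hZ.eventually_hasDerivAt_iteratedDeriv (k := 3) (by norm_num)).self_of_nhds
  simp only [iteratedDeriv_zero, zero_add, Nat.reduceAdd] at w1 w2 w3 z0 z1 z2 z3
  have c1 := w1.comp x₀ z0
  have c2 := w2.comp x₀ z0
  have c3 := w3.comp x₀ z0
  have e : iteratedDeriv 3 W =ᶠ[𝓝 x₀] _ := h.mono fun x hx => hx.2.2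
  rw [iteratedDeriv_succ, e.deriv_eq]
  refine ((((c3.mul (z1.pow 3)).add (((c2.const_mul 3).mul z1).mul z2)).add
    (c1.mul z3)).congr_deriv ?_).deriv
  simp only [Function.comp_apply, Pi.mul_apply, Pi.pow_apply]
  push_cast
  ring

/-- A parametrized curve `(Z, W)` with `Z' ≠ 0` is locally the graph of a function `w`, as smooth
as `Z` and `W`. -/
theorem exists_comp_eq_of_deriv_ne_zero {Z W : ℝ → ℝ} {x₀ : ℝ} {n : ℕ} (hn : n ≠ 0)
    (hZ : ContDiffAt ℝ n Z x₀) (hW : ContDiffAt ℝ n W x₀) (h : deriv Z x₀ ≠ 0) :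
    ∃ w : ℝ → ℝ, ContDiffAt ℝ n w (Z x₀) ∧ ∀ᶠ x in 𝓝 x₀, w (Z x) = W x := by
  have hn' : (n : WithTop ℕ∞) ≠ 0 := by exact_mod_cast hn
  have hd : HasDerivAt Z (deriv Z x₀) x₀ := (hZ.differentiableAt hn').hasDerivAt
  have hf : HasFDerivAt Z
      (ContinuousLinearEquiv.unitsEquivAut ℝ (Units.mk0 _ h) : ℝ →L[ℝ] ℝ) x₀ := by
    convert! hd.hasFDerivAt using 1
  refine ⟨W ∘ hZ.localInverse hf hn', ?_, ?_⟩
  · have h1 := hZ.to_localInverse hf hn'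
    refine ContDiffAt.comp _ ?_ h1
    rwa [hZ.localInverse_apply_image hf hn']
  · filter_upwards [(hZ.hasStrictFDerivAt' hf hn').eventually_left_inverse] with x hx
    exact congrArg W hx

/-! ### Jets along a curve in the plane -/

section partials
variable {g : ℝ × ℝ → ℝ} {V : Set (ℝ × ℝ)} {p : ℝ × ℝ} {k : ℕ}

theorem partialX_eq_fderiv (hg : DifferentiableAt ℝ g p) : partialX g p = fderiv ℝ g p (1, 0) := by
  have h : HasDerivAt (fun x : ℝ => (x, p.2)) ((1 : ℝ), (0 : ℝ)) p.1 :=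
    (hasDerivAt_id p.1).prodMk (hasDerivAt_const p.1 p.2)
  exact (hg.hasFDerivAt.comp_hasDerivAt p.1 h).deriv

theorem partialY_eq_fderiv (hg : DifferentiableAt ℝ g p) : partialY g p = fderiv ℝ g p (0, 1) := by
  have h : HasDerivAt (fun y : ℝ => (p.1, y)) ((0 : ℝ), (1 : ℝ)) p.2 :=
    (hasDerivAt_const p.2 p.1).prodMk (hasDerivAt_id p.2)
  exact (hg.hasFDerivAt.comp_hasDerivAt p.2 h).deriv

theorem ContDiffOn.differentiableAt_of_mem (hg : ContDiffOn ℝ (k + 1 : ℕ) g V) (hV : IsOpen V)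
    (hp : p ∈ V) : DifferentiableAt ℝ g p :=
  (hg.contDiffAt (hV.mem_nhds hp)).differentiableAt (by simp)

theorem contDiffOn_partialX (hg : ContDiffOn ℝ (k + 1 : ℕ) g V) (hV : IsOpen V) :
    ContDiffOn ℝ k (partialX g) V :=
  ((hg.fderiv_of_isOpen (m := k) hV (by simp)).clm_apply contDiffOn_const).congr
    fun _ hp => partialX_eq_fderiv (hg.differentiableAt_of_mem hV hp)

theorem contDiffOn_partialY (hg : ContDiffOn ℝ (k + 1 : ℕ) g V) (hV : IsOpen V) :
    ContDiffOn ℝ k (partialY g) V :=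
  ((hg.fderiv_of_isOpen (m := k) hV (by simp)).clm_apply contDiffOn_const).congr
    fun _ hp => partialY_eq_fderiv (hg.differentiableAt_of_mem hV hp)

theorem hasDerivAt_partialY (hg : ContDiffOn ℝ (k + 1 : ℕ) g V) (hV : IsOpen V) (hp : p ∈ V) :
    HasDerivAt (fun y => g (p.1, y)) (partialY g p) p.2 := by
  have h : HasDerivAt (fun y : ℝ => (p.1, y)) ((0 : ℝ), (1 : ℝ)) p.2 :=
    (hasDerivAt_const p.2 p.1).prodMk (hasDerivAt_id p.2)
  exact ((hg.differentiableAt_of_mem hV hp).comp p.2 h.differentiableAt).hasDerivAt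

variable {y : ℝ → ℝ} {x₀ : ℝ}

theorem contDiffAt_along (hg : ContDiffOn ℝ k g V) (hV : IsOpen V) (hp : (x₀, y x₀) ∈ V)
    (hy : ContDiffAt ℝ k y x₀) : ContDiffAt ℝ k (fun x => g (x, y x)) x₀ :=
  (hg.contDiffAt (hV.mem_nhds hp)).comp x₀ (contDiffAt_id.prodMk hy)

theorem eventually_graph_mem (hV : IsOpen V) (hp : (x₀, y x₀) ∈ V) (hy : ContinuousAt y x₀) :
    ∀ᶠ x in 𝓝 x₀, (x, y x) ∈ V :=
  (continuousAt_id.prodMk hy).eventually (hV.mem_nhds hp)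

theorem hasDerivAt_along {y' : ℝ} (hg : ContDiffOn ℝ (k + 1 : ℕ) g V) (hV : IsOpen V)
    (hp : (x₀, y x₀) ∈ V) (hy : HasDerivAt y y' x₀) :
    HasDerivAt (fun x => g (x, y x))
      (partialX g (x₀, y x₀) + partialY g (x₀, y x₀) * y') x₀ := by
  have hd := hg.differentiableAt_of_mem hV hp
  refine (hd.hasFDerivAt.comp_hasDerivAt x₀ ((hasDerivAt_id x₀).prodMk hy)).congr_deriv ?_
  rw [partialX_eq_fderiv hd, partialY_eq_fderiv hd, mul_comm, ← smul_eq_mul, ← map_smul, ← map_add]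
  simp

/-- The chain rule `d/dx g(x, y) = g_x + g_y y'`, differentiated `k` more times by Leibniz. It
reduces the `(k + 1)`-st derivative along the curve to lower derivatives of `g_x` and `g_y`. -/
theorem iteratedDeriv_succ_along (hg : ContDiffOn ℝ (k + 1 : ℕ) g V) (hV : IsOpen V)
    (hp : (x₀, y x₀) ∈ V) (hy : ContDiffAt ℝ (k + 1 : ℕ) y x₀) :
    iteratedDeriv (k + 1) (fun x => g (x, y x)) x₀ =
      iteratedDeriv k (fun x => partialX g (x, y x)) x₀ +
      ∑ i ∈ Finset.range (k + 1), (k.choose i : ℝ) *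
        iteratedDeriv i (fun x => partialY g (x, y x)) x₀ * iteratedDeriv (k - i + 1) y x₀ := by
  have hyd := hy.eventually_hasDerivAt_iteratedDeriv (k := 0) (by simp)
  simp only [iteratedDeriv_zero, zero_add] at hyd
  have hy' : ContDiffAt ℝ k y x₀ := hy.of_le (by simp)
  have hy1 : ContDiffAt ℝ k (iteratedDeriv 1 y) x₀ := by
    rw [iteratedDeriv_one]
    exact hy.derivWithin (by simp)
  have H : ∀ᶠ x in 𝓝 x₀, HasDerivAt (fun x => g (x, y x))
      (((fun x => partialX g (x, y x)) +
        (fun x => partialY g (x, y x)) * iteratedDeriv 1 y) x) x := by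
    filter_upwards [eventually_graph_mem hV hp hy.continuousAt, hyd] with x hx hyx
    exact hasDerivAt_along hg hV hx hyx
  have hX := contDiffAt_along (contDiffOn_partialX hg hV) hV hp hy'
  have hY := contDiffAt_along (contDiffOn_partialY hg hV) hV hp hy'
  have hYy : ContDiffAt ℝ k ((fun x => partialY g (x, y x)) * iteratedDeriv 1 y) x₀ := hY.mul hy1
  rw [iteratedDeriv_succ_of_eventually_hasDerivAt H, iteratedDeriv_add hX hYy,
    iteratedDeriv_mul hY hy1]
  simp only [iteratedDeriv_one, ← iteratedDeriv_succ']

end partials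

section jets
variable {g : ℝ × ℝ → ℝ} {V : Set (ℝ × ℝ)} {p : ℝ × ℝ}

theorem iteratedDeriv_one_along {y : ℝ → ℝ} (hV : IsOpen V) (hp : p ∈ V)
    (hg : ContDiffOn ℝ 1 g V) (hy : ContDiffAt ℝ 1 y p.1) (hyp : y p.1 = p.2) :
    iteratedDeriv 1 (fun x => g (x, y x)) p.1
      = partialX g p + partialY g p * iteratedDeriv 1 y p.1 := by
  obtain ⟨x₀, y₀⟩ := p
  obtain rfl : y x₀ = y₀ := hyp
  have := iteratedDeriv_succ_along (k := 0) hg hV hp hy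
  simpa [Finset.sum_range_succ] using this

/-- The second derivative along a curve, as a polynomial in the 2-jet of the curve. Only the
coefficients of `y'²` and `y''` matter later, so the others are left unnamed. -/
theorem exists_iteratedDeriv_two_along (hV : IsOpen V) (hp : p ∈ V) (hg : ContDiffOn ℝ 2 g V) :
    ∃ A B : ℝ, ∀ y : ℝ → ℝ, ContDiffAt ℝ 2 y p.1 → y p.1 = p.2 →
      iteratedDeriv 2 (fun x => g (x, y x)) p.1 = A + B * iteratedDeriv 1 y p.1
        + partialY (partialY g) p * iteratedDeriv 1 y p.1 ^ 2
        + partialY g p * iteratedDeriv 2 y p.1 := by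
  refine ⟨partialX (partialX g) p, partialY (partialX g) p + partialX (partialY g) p,
    fun y hy hyp => ?_⟩
  have hy1 := hy.of_le (m := 1) (by norm_num)
  have h := iteratedDeriv_succ_along (k := 1) hg hV (by rwa [hyp] : (p.1, y p.1) ∈ V) hy
  rw [iteratedDeriv_one_along hV hp (contDiffOn_partialX hg hV) hy1 hyp] at h
  simp only [Finset.sum_range_succ, Finset.sum_range_zero, iteratedDeriv_zero] at h
  rw [iteratedDeriv_one_along hV hp (contDiffOn_partialY hg hV) hy1 hyp, hyp] at h
  norm_num at h
  simp only [iteratedDeriv_one] at h ⊢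
  rw [h]
  ring

/-- The third derivative along a curve: the coefficient of `y''` is affine in `y'`, with slope
`3 g_yy`. The part depending on `y'` alone is an unspecified function `q`. -/
theorem exists_iteratedDeriv_three_along (hV : IsOpen V) (hp : p ∈ V) (hg : ContDiffOn ℝ 3 g V) :
    ∃ (q : ℝ → ℝ) (K : ℝ), ∀ y : ℝ → ℝ, ContDiffAt ℝ 3 y p.1 → y p.1 = p.2 →
      iteratedDeriv 3 (fun x => g (x, y x)) p.1 = q (iteratedDeriv 1 y p.1)
        + (K + 3 * partialY (partialY g) p * iteratedDeriv 1 y p.1) * iteratedDeriv 2 y p.1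
        + partialY g p * iteratedDeriv 3 y p.1 := by
  have hgx : ContDiffOn ℝ 2 (partialX g) V := contDiffOn_partialX (k := 2) hg hV
  have hgy : ContDiffOn ℝ 2 (partialY g) V := contDiffOn_partialY (k := 2) hg hV
  obtain ⟨Ax, Bx, hx⟩ := exists_iteratedDeriv_two_along hV hp hgx
  obtain ⟨Ay, By, hy⟩ := exists_iteratedDeriv_two_along hV hp hgy
  refine ⟨fun m => Ax + Bx * m + partialY (partialY (partialX g)) p * m ^ 2
      + (Ay + By * m + partialY (partialY (partialY g)) p * m ^ 2) * m,
    partialY (partialX g) p + 2 * partialX (partialY g) p, fun y hy3 hyp => ?_⟩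
  have hy1 := hy3.of_le (m := 1) (by norm_num)
  have hy2 := hy3.of_le (m := 2) (by norm_num)
  have h := iteratedDeriv_succ_along (k := 2) hg hV (by rwa [hyp] : (p.1, y p.1) ∈ V) hy3
  simp only [Finset.sum_range_succ, Finset.sum_range_zero, iteratedDeriv_zero] at h
  rw [hx y hy2 hyp, hy y hy2 hyp,
    iteratedDeriv_one_along hV hp (hgy.of_le (by norm_num)) hy1 hyp, hyp] at h
  norm_num at h
  simp only [iteratedDeriv_one] at h ⊢
  rw [h]
  ring

/-- The fourth derivative along a curve: the coefficient of `y'''` is affine in `y'`, with slope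
`4 g_yy`, and the only other nonlinearity in `(y'', y''')` is the term `3 g_yy y''²`. -/
theorem exists_iteratedDeriv_four_along (hV : IsOpen V) (hp : p ∈ V) (hg : ContDiffOn ℝ 4 g V) :
    ∃ (q s : ℝ → ℝ) (K : ℝ), ∀ y : ℝ → ℝ, ContDiffAt ℝ 4 y p.1 → y p.1 = p.2 →
      iteratedDeriv 4 (fun x => g (x, y x)) p.1 = q (iteratedDeriv 1 y p.1)
        + s (iteratedDeriv 1 y p.1) * iteratedDeriv 2 y p.1
        + 3 * partialY (partialY g) p * iteratedDeriv 2 y p.1 ^ 2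
        + (K + 4 * partialY (partialY g) p * iteratedDeriv 1 y p.1) * iteratedDeriv 3 y p.1
        + partialY g p * iteratedDeriv 4 y p.1 := by
  have hgx : ContDiffOn ℝ 3 (partialX g) V := contDiffOn_partialX (k := 3) hg hV
  have hgy : ContDiffOn ℝ 3 (partialY g) V := contDiffOn_partialY (k := 3) hg hV
  obtain ⟨qx, Kx, hx⟩ := exists_iteratedDeriv_three_along hV hp hgx
  obtain ⟨qy, Ky, hy⟩ := exists_iteratedDeriv_three_along hV hp hgy
  obtain ⟨A, B, hy'⟩ := exists_iteratedDeriv_two_along hV hp (hgy.of_le (by norm_num))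
  refine ⟨fun m => qx m + qy m * m,
    fun m => Kx + 3 * partialY (partialY (partialX g)) p * m
      + (Ky + 3 * partialY (partialY (partialY g)) p * m) * m
      + 3 * (A + B * m + partialY (partialY (partialY g)) p * m ^ 2),
    partialY (partialX g) p + 3 * partialX (partialY g) p, fun y hy4 hyp => ?_⟩
  have hy1 := hy4.of_le (m := 1) (by norm_num)
  have hy2 := hy4.of_le (m := 2) (by norm_num)
  have hy3 := hy4.of_le (m := 3) (by norm_num)
  have h := iteratedDeriv_succ_along (k := 3) hg hV (by rwa [hyp] : (p.1, y p.1) ∈ V) hy4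
  simp only [Finset.sum_range_succ, Finset.sum_range_zero, iteratedDeriv_zero] at h
  rw [hx y hy3 hyp, hy y hy3 hyp, hy' y hy2 hyp,
    iteratedDeriv_one_along hV hp (hgy.of_le (by norm_num)) hy1 hyp, hyp] at h
  norm_num [Nat.choose] at h
  simp only [iteratedDeriv_one] at h ⊢
  rw [h]
  ring

/-- The polynomial with prescribed derivatives `m₀, …, m₄` at `x₀`. -/
noncomputable def jetPoly (x₀ m₀ m₁ m₂ m₃ m₄ : ℝ) : ℝ → ℝ := fun x =>
  m₀ + m₁ * (x - x₀) + m₂ / 2 * (x - x₀) ^ 2 + m₃ / 6 * (x - x₀) ^ 3 + m₄ / 24 * (x - x₀) ^ 4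

theorem contDiff_jetPoly {n : WithTop ℕ∞} (x₀ m₀ m₁ m₂ m₃ m₄ : ℝ) :
    ContDiff ℝ n (jetPoly x₀ m₀ m₁ m₂ m₃ m₄) := by
  unfold jetPoly
  fun_prop

theorem jetPoly_self (x₀ m₀ m₁ m₂ m₃ m₄ : ℝ) : jetPoly x₀ m₀ m₁ m₂ m₃ m₄ x₀ = m₀ := by
  simp [jetPoly]

theorem iteratedDeriv_succ_jetPoly (x₀ m₀ m₁ m₂ m₃ m₄ : ℝ) (k : ℕ) :
    iteratedDeriv (k + 1) (jetPoly x₀ m₀ m₁ m₂ m₃ m₄)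
      = iteratedDeriv k (jetPoly x₀ m₁ m₂ m₃ m₄ 0) := by
  rw [iteratedDeriv_succ']
  congr 1
  ext x
  have h : HasDerivAt (fun x => x - x₀) 1 x := (hasDerivAt_id x).sub_const x₀
  refine ((((((hasDerivAt_const x m₀).add (h.const_mul m₁)).add ((h.pow 2).const_mul (m₂ / 2))).add
    ((h.pow 3).const_mul (m₃ / 6))).add ((h.pow 4).const_mul (m₄ / 24))).congr_deriv ?_).deriv
  simp only [jetPoly]
  push_cast
  ring

theorem iteratedDeriv_jetPoly (x₀ m₀ m₁ m₂ m₃ m₄ : ℝ) :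
    iteratedDeriv 1 (jetPoly x₀ m₀ m₁ m₂ m₃ m₄) x₀ = m₁ ∧
    iteratedDeriv 2 (jetPoly x₀ m₀ m₁ m₂ m₃ m₄) x₀ = m₂ ∧
    iteratedDeriv 3 (jetPoly x₀ m₀ m₁ m₂ m₃ m₄) x₀ = m₃ ∧
    iteratedDeriv 4 (jetPoly x₀ m₀ m₁ m₂ m₃ m₄) x₀ = m₄ := by
  refine ⟨?_, ?_, ?_, ?_⟩ <;>
    simp only [iteratedDeriv_succ_jetPoly, iteratedDeriv_zero, jetPoly_self]

end jets

/-! ### The independent variable transforms by itself: `ρ_y = 0` -/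

section transformation
variable {F ρ ψ : ℝ × ℝ → ℝ} {V : Set (ℝ × ℝ)} {p : ℝ × ℝ} {a : ℕ → ℝ → ℝ} {b : ℝ → ℝ}

/-- The third-order equation in jet coordinates: it is affine in `y''`, and neither `y' y''` nor
`y''²` occurs. -/
theorem exists_chainExpr_three_jet (hV : IsOpen V) (hF : ContDiffOn ℝ 2 F V) (hp : p ∈ V) :
    ∃ α β : ℝ, ∀ y : ℝ → ℝ, ContDiffAt ℝ 3 y p.1 → y p.1 = p.2 →
      chainExpr F 3 y p.1 = iteratedDeriv 3 y p.1
        + (3 * F p + p.2 * partialY F p) * iteratedDeriv 2 y p.1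
        + (α + β * iteratedDeriv 1 y p.1
          + (3 * partialY F p + p.2 * partialY (partialY F) p) * iteratedDeriv 1 y p.1 ^ 2) := by
  obtain ⟨A, B, h2⟩ := exists_iteratedDeriv_two_along hV hp hF
  refine ⟨(A + 3 * F p * partialX F p + F p ^ 3) * p.2,
    3 * (partialX F p + F p ^ 2) + (B + 3 * F p * partialY F p) * p.2, fun y hy hyp => ?_⟩
  have hy2 := hy.of_le (m := 2) (by norm_num)
  rw [chainExpr_three (f := fun x => F (x, y x)) (.of_forall fun _ => rfl)
    (contDiffAt_along (k := 2) hF hV (by rwa [hyp]) hy2) hy, h2 y hy2 hyp,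
    iteratedDeriv_one_along hV hp (hF.of_le (by norm_num)) (hy.of_le (by norm_num)) hyp, hyp]
  ring

/-- The fourth-order equation in jet coordinates: neither `y'' y'''` nor `y' y'''` nor `y''²`
occurs. -/
theorem exists_chainExpr_four_jet (hV : IsOpen V) (hF : ContDiffOn ℝ 3 F V) (hp : p ∈ V) :
    ∃ (q : ℝ → ℝ) (s : ℝ), ∀ y : ℝ → ℝ, ContDiffAt ℝ 4 y p.1 → y p.1 = p.2 →
      chainExpr F 4 y p.1 = iteratedDeriv 4 y p.1
        + (4 * F p + p.2 * partialY F p) * iteratedDeriv 3 y p.1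
        + (s + (10 * partialY F p + 3 * p.2 * partialY (partialY F) p) * iteratedDeriv 1 y p.1)
          * iteratedDeriv 2 y p.1
        + q (iteratedDeriv 1 y p.1) := by
  have hF2 : ContDiffOn ℝ 2 F V := hF.of_le (by norm_num)
  obtain ⟨A, B, h2⟩ := exists_iteratedDeriv_two_along hV hp hF2
  obtain ⟨q, K, h3⟩ := exists_iteratedDeriv_three_along hV hp hF
  refine ⟨fun m => 4 * (A + B * m + partialY (partialY F) p * m ^ 2
        + 3 * F p * (partialX F p + partialY F p * m) + F p ^ 3) * m
      + (q m + 4 * F p * (A + B * m + partialY (partialY F) p * m ^ 2)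
        + 3 * (partialX F p + partialY F p * m) ^ 2
        + 6 * F p ^ 2 * (partialX F p + partialY F p * m) + F p ^ 4) * p.2,
    6 * (partialX F p + F p ^ 2) + K * p.2 + 4 * F p * partialY F p * p.2, fun y hy hyp => ?_⟩
  have hy2 := hy.of_le (m := 2) (by norm_num)
  have hy3 := hy.of_le (m := 3) (by norm_num)
  rw [chainExpr_four (f := fun x => F (x, y x)) (.of_forall fun _ => rfl)
    (contDiffAt_along (k := 3) hF hV (by rwa [hyp]) hy3) hy, h2 y hy2 hyp, h3 y hy3 hyp,
    iteratedDeriv_one_along hV hp (hF.of_le (by norm_num)) (hy.of_le (by norm_num)) hyp, hyp]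
  ring

/-- The hypothesis on the point transformation, on the level of 3-jets: the jet `w₁, w₂, w₃` of the
transformed curve is determined by Faà di Bruno's formulas from the derivatives of `z = ρ(x, y(x))`
and `w = ψ(x, y(x))`, and it solves the linear equation exactly when `y` solves the original one. -/
theorem CarriesToLinearOn.exists_jet_three (h : CarriesToLinearOn 3 F ρ ψ a b V) (hV : IsOpen V)
    (hρ : ContDiffOn ℝ 3 ρ V) (hψ : ContDiffOn ℝ 3 ψ V) {y : ℝ → ℝ} (hy : ContDiffAt ℝ 3 y p.1)
    (hyp : y p.1 = p.2) (hp : p ∈ V) (hZ : iteratedDeriv 1 (fun x => ρ (x, y x)) p.1 ≠ 0) :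
    ∃ w₁ w₂ w₃ : ℝ,
      iteratedDeriv 1 (fun x => ψ (x, y x)) p.1 =
        w₁ * iteratedDeriv 1 (fun x => ρ (x, y x)) p.1 ∧
      iteratedDeriv 2 (fun x => ψ (x, y x)) p.1 =
        w₂ * iteratedDeriv 1 (fun x => ρ (x, y x)) p.1 ^ 2
        + w₁ * iteratedDeriv 2 (fun x => ρ (x, y x)) p.1 ∧
      iteratedDeriv 3 (fun x => ψ (x, y x)) p.1 =
        w₃ * iteratedDeriv 1 (fun x => ρ (x, y x)) p.1 ^ 3
        + 3 * w₂ * iteratedDeriv 1 (fun x => ρ (x, y x)) p.1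
          * iteratedDeriv 2 (fun x => ρ (x, y x)) p.1
        + w₁ * iteratedDeriv 3 (fun x => ρ (x, y x)) p.1 ∧
      (chainExpr F 3 y p.1 = 0 ↔
        w₃ + a 2 (ρ p) * w₂ + a 1 (ρ p) * w₁ + (a 0 (ρ p) * ψ p + b (ρ p)) = 0) := by
  have hp' : (p.1, y p.1) ∈ V := by rwa [hyp]
  have hZc := contDiffAt_along (k := 3) hρ hV hp' hy
  have hWc := contDiffAt_along (k := 3) hψ hV hp' hy
  rw [iteratedDeriv_one] at hZ
  obtain ⟨w, hw, hwZ⟩ := exists_comp_eq_of_deriv_ne_zero (n := 3) (by norm_num) hZc hWc hZ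
  have hc := (eventually_iteratedDeriv_comp hw hZc hwZ).self_of_nhds
  refine ⟨_, _, _, hc.1, hc.2.1, hc.2.2, ?_⟩
  have hlin := h p.1 y w hy hp' hZ hw hwZ
  have hw0 := hwZ.self_of_nhds
  simp only [hyp, Prod.mk.eta] at hlin hw0 ⊢
  rw [hlin, linearExpr]
  simp only [Finset.sum_range_succ, Finset.sum_range_zero, iteratedDeriv_zero, hw0]
  ring_nf

/-- The hypothesis on the point transformation, on the level of 4-jets. -/
theorem CarriesToLinearOn.exists_jet_four (h : CarriesToLinearOn 4 F ρ ψ a b V) (hV : IsOpen V)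
    (hρ : ContDiffOn ℝ 4 ρ V) (hψ : ContDiffOn ℝ 4 ψ V) {y : ℝ → ℝ} (hy : ContDiffAt ℝ 4 y p.1)
    (hyp : y p.1 = p.2) (hp : p ∈ V) (hZ : iteratedDeriv 1 (fun x => ρ (x, y x)) p.1 ≠ 0) :
    ∃ w₁ w₂ w₃ w₄ : ℝ,
      iteratedDeriv 1 (fun x => ψ (x, y x)) p.1 =
        w₁ * iteratedDeriv 1 (fun x => ρ (x, y x)) p.1 ∧
      iteratedDeriv 2 (fun x => ψ (x, y x)) p.1 =
        w₂ * iteratedDeriv 1 (fun x => ρ (x, y x)) p.1 ^ 2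
        + w₁ * iteratedDeriv 2 (fun x => ρ (x, y x)) p.1 ∧
      iteratedDeriv 3 (fun x => ψ (x, y x)) p.1 =
        w₃ * iteratedDeriv 1 (fun x => ρ (x, y x)) p.1 ^ 3
        + 3 * w₂ * iteratedDeriv 1 (fun x => ρ (x, y x)) p.1
          * iteratedDeriv 2 (fun x => ρ (x, y x)) p.1
        + w₁ * iteratedDeriv 3 (fun x => ρ (x, y x)) p.1 ∧
      iteratedDeriv 4 (fun x => ψ (x, y x)) p.1 =
        w₄ * iteratedDeriv 1 (fun x => ρ (x, y x)) p.1 ^ 4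
        + 6 * w₃ * iteratedDeriv 1 (fun x => ρ (x, y x)) p.1 ^ 2
          * iteratedDeriv 2 (fun x => ρ (x, y x)) p.1
        + w₂ * (3 * iteratedDeriv 2 (fun x => ρ (x, y x)) p.1 ^ 2
          + 4 * iteratedDeriv 1 (fun x => ρ (x, y x)) p.1
            * iteratedDeriv 3 (fun x => ρ (x, y x)) p.1)
        + w₁ * iteratedDeriv 4 (fun x => ρ (x, y x)) p.1 ∧
      (chainExpr F 4 y p.1 = 0 ↔
        w₄ + a 3 (ρ p) * w₃ + a 2 (ρ p) * w₂ + a 1 (ρ p) * w₁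
          + (a 0 (ρ p) * ψ p + b (ρ p)) = 0) := by
  have hp' : (p.1, y p.1) ∈ V := by rwa [hyp]
  have hZc := contDiffAt_along (k := 4) hρ hV hp' hy
  have hWc := contDiffAt_along (k := 4) hψ hV hp' hy
  rw [iteratedDeriv_one] at hZ
  obtain ⟨w, hw, hwZ⟩ := exists_comp_eq_of_deriv_ne_zero (n := 4) (by norm_num) hZc hWc hZ
  have hc := (eventually_iteratedDeriv_comp (hw.of_le (by norm_num)) (hZc.of_le (by norm_num))
    hwZ).self_of_nhds
  refine ⟨_, _, _, _, hc.1, hc.2.1, hc.2.2, iteratedDeriv_four_comp hw hZc hwZ, ?_⟩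
  have hlin := h p.1 y w hy hp' hZ hw hwZ
  have hw0 := hwZ.self_of_nhds
  simp only [hyp, Prod.mk.eta] at hlin hw0 ⊢
  rw [hlin, linearExpr]
  simp only [Finset.sum_range_succ, Finset.sum_range_zero, iteratedDeriv_zero, hw0]
  ring_nf

/-- The elimination behind `ρ_y = 0` for third order. Here `r = ρ_y`, `s = ψ_y`, `D = dz/dx`,
`W₁ = dw/dx`, and `c` is the free value of `y''`, while `y''' = -(g c + q)` is prescribed by the
equation. The second difference in `c` isolates `y''²`, whose coefficient is a nonzero multiple of
`r (D s - W₁ r)`; the second factor is the Jacobian. -/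
theorem eq_zero_of_jets_three {D W₁ r s z₂ z₃ l e₂ e₃ L g q a₁ a₂ a₀ : ℝ}
    (hD : D ≠ 0) (hJ : D * s - W₁ * r ≠ 0)
    (H : ∀ c : ℝ, ∃ w₁ w₂ w₃ : ℝ, W₁ = w₁ * D ∧
      e₂ + s * c = w₂ * D ^ 2 + w₁ * (z₂ + r * c) ∧
      e₃ + L * c + s * -(g * c + q) = w₃ * D ^ 3 + 3 * w₂ * D * (z₂ + r * c)
        + w₁ * (z₃ + l * c + r * -(g * c + q)) ∧
      w₃ + a₂ * w₂ + a₁ * w₁ + a₀ = 0) : r = 0 := by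
  obtain ⟨w₁, u₂, u₃, h1, h2, h3, h4⟩ := H 0
  obtain ⟨w₁', v₂, v₃, k1, k2, k3, k4⟩ := H 1
  obtain ⟨w₁'', x₂, x₃, l1, l2, l3, l4⟩ := H (-1)
  obtain rfl : w₁' = w₁ := mul_right_cancel₀ hD (k1.symm.trans h1)
  obtain rfl : w₁'' = w₁' := mul_right_cancel₀ hD (l1.symm.trans h1)
  have e2 : v₂ + x₂ - 2 * u₂ = 0 := by
    refine (mul_eq_zero.mp ?_).resolve_right (pow_ne_zero 2 hD)
    linear_combination 2 * h2 - k2 - l2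
  have e3 : v₃ + x₃ - 2 * u₃ = 0 := by linear_combination k4 + l4 - 2 * h4 - a₂ * e2
  have hmul : r * (v₂ - x₂) * D = 0 := by
    linear_combination (2 * h3 - k3 - l3 - D ^ 3 * e3 - 3 * D * z₂ * e2) / 3
  have hJ' : D * (D ^ 2 * (v₂ - x₂)) = 2 * (D * s - W₁ * r) := by
    linear_combination D * (l2 - k2) + 2 * r * h1
  rcases mul_eq_zero.mp hmul with h | h
  · rcases mul_eq_zero.mp h with h | h
    · exact h
    · rw [h] at hJ'
      exact absurd (by linear_combination - hJ' / 2) hJ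
  · exact absurd h hD

/-- The elimination behind `ρ_y = 0` for fourth order. Here `r = ρ_y`, `s = ψ_y`, `D = dz/dx`,
`W₁ = dw/dx`, and `c`, `d` are the free values of `y''`, `y'''`, while `y''''` is prescribed by the
equation. The mixed second difference in `c` and `d` isolates `y'' y'''`, whose coefficient is a
nonzero multiple of `r (D s - W₁ r)`; the second factor is the Jacobian. -/
theorem eq_zero_of_jets_four {D W₁ r s z₂ z₃ z₄ l e₂ e₃ e₄ L g q k S P T t R K a₀ a₁ a₂ a₃ : ℝ}
    (hD : D ≠ 0) (hJ : D * s - W₁ * r ≠ 0)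
    (H : ∀ c d : ℝ, ∃ w₁ w₂ w₃ w₄ : ℝ, W₁ = w₁ * D ∧
      e₂ + s * c = w₂ * D ^ 2 + w₁ * (z₂ + r * c) ∧
      e₃ + L * c + s * d = w₃ * D ^ 3 + 3 * w₂ * D * (z₂ + r * c)
        + w₁ * (z₃ + l * c + r * d) ∧
      e₄ + S * c + P * c ^ 2 + K * d + s * -(g * d + t * c + q) = w₄ * D ^ 4
        + 6 * w₃ * D ^ 2 * (z₂ + r * c)
        + w₂ * (3 * (z₂ + r * c) ^ 2 + 4 * D * (z₃ + l * c + r * d))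
        + w₁ * (z₄ + T * c + R * c ^ 2 + k * d + r * -(g * d + t * c + q)) ∧
      w₄ + a₃ * w₃ + a₂ * w₂ + a₁ * w₁ + a₀ = 0) : r = 0 := by
  obtain ⟨w₁, u₂, u₃, u₄, h1, h2, h3, h4, h5⟩ := H 0 0
  obtain ⟨w₁', v₂, v₃, v₄, k1, k2, k3, k4, k5⟩ := H 1 0
  obtain ⟨w₁'', x₂, x₃, x₄, l1, l2, l3, l4, l5⟩ := H 0 1
  obtain ⟨w₁''', y₂, y₃, y₄, m1, m2, m3, m4, m5⟩ := H 1 1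
  obtain rfl : w₁' = w₁ := mul_right_cancel₀ hD (k1.symm.trans h1)
  obtain rfl : w₁'' = w₁' := mul_right_cancel₀ hD (l1.symm.trans h1)
  obtain rfl : w₁''' = w₁'' := mul_right_cancel₀ hD (m1.symm.trans h1)
  obtain rfl : x₂ = u₂ := by
    refine mul_right_cancel₀ (pow_ne_zero 2 hD) ?_
    linear_combination h2 - l2
  obtain rfl : y₂ = v₂ := by
    refine mul_right_cancel₀ (pow_ne_zero 2 hD) ?_
    linear_combination k2 - m2
  have e3 : y₃ - v₃ - x₃ + u₃ = 0 := by
    refine (mul_eq_zero.mp ?_).resolve_right (pow_ne_zero 3 hD)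
    linear_combination k3 + l3 - m3 - h3
  have e4 : y₄ - v₄ - x₄ + u₄ = 0 := by linear_combination m5 + h5 - k5 - l5 - a₃ * e3
  have hu : D * (D ^ 2 * (y₂ - x₂)) = D * s - W₁ * r := by
    linear_combination D * (h2 - k2) + r * h1
  have hv : D * (D ^ 3 * (y₃ - v₃)) = D * s - W₁ * r := by
    linear_combination D * (k3 - m3) + r * h1
  have hmul : 6 * D ^ 2 * r * (y₃ - v₃) + 4 * D * r * (y₂ - x₂) = 0 := by
    linear_combination k4 + l4 - m4 - h4 - D ^ 4 * e4 - 6 * D ^ 2 * z₂ * e3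
  have : r * (D * s - W₁ * r) = 0 := by
    linear_combination (D ^ 2 * hmul - 6 * r * hv - 4 * r * hu) / 10
  exact (mul_eq_zero.mp this).resolve_right hJ

/-- Some direction `(1, m)` is transversal to the kernel of `dρ`. -/
theorem exists_add_mul_ne_zero {A B C E : ℝ} (h : A * E - B * C ≠ 0) : ∃ m : ℝ, A + B * m ≠ 0 := by
  by_cases hA : A = 0
  · refine ⟨1, fun hB => h ?_⟩
    subst hA
    have : B = 0 := by linarith
    simp [this]
  · exact ⟨0, by simpa using hA⟩

theorem CarriesToLinearOn.partialY_fst_eq_zero_three (h : CarriesToLinearOn 3 F ρ ψ a b V)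
    (hV : IsOpen V) (hF : ContDiffOn ℝ 2 F V)
    (hρ : ContDiffOn ℝ 3 ρ V) (hψ : ContDiffOn ℝ 3 ψ V) (hp : p ∈ V)
    (hJ : partialX ρ p * partialY ψ p - partialY ρ p * partialX ψ p ≠ 0) :
    partialY ρ p = 0 := by
  obtain ⟨m, hm⟩ := exists_add_mul_ne_zero hJ
  obtain ⟨A, B, hE⟩ := exists_chainExpr_three_jet hV hF hp
  obtain ⟨Aρ, Bρ, hρ2⟩ := exists_iteratedDeriv_two_along hV hp (hρ.of_le (by norm_num))
  obtain ⟨Aψ, Bψ, hψ2⟩ := exists_iteratedDeriv_two_along hV hp (hψ.of_le (by norm_num))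
  obtain ⟨qρ, Kρ, hρ3⟩ := exists_iteratedDeriv_three_along hV hp hρ
  obtain ⟨qψ, Kψ, hψ3⟩ := exists_iteratedDeriv_three_along hV hp hψ
  refine eq_zero_of_jets_three (s := partialY ψ p) hm
    (W₁ := partialX ψ p + partialY ψ p * m) (by convert hJ using 1; ring) (fun c => ?_)
    (g := 3 * F p + p.2 * partialY F p)
    (q := A + B * m + (3 * partialY F p + p.2 * partialY (partialY F) p) * m ^ 2)
    (e₂ := Aψ + Bψ * m + partialY (partialY ψ) p * m ^ 2)
    (z₂ := Aρ + Bρ * m + partialY (partialY ρ) p * m ^ 2)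
    (e₃ := qψ m) (z₃ := qρ m) (L := Kψ + 3 * partialY (partialY ψ) p * m)
    (l := Kρ + 3 * partialY (partialY ρ) p * m)
    (a₀ := a 0 (ρ p) * ψ p + b (ρ p)) (a₁ := a 1 (ρ p)) (a₂ := a 2 (ρ p))
  set d := -((3 * F p + p.2 * partialY F p) * c
    + (A + B * m + (3 * partialY F p + p.2 * partialY (partialY F) p) * m ^ 2)) with hd
  set y := jetPoly p.1 p.2 m c d 0 with hy
  have hyc : ContDiffAt ℝ 3 y p.1 := (contDiff_jetPoly ..).contDiffAt
  have hyp : y p.1 = p.2 := jetPoly_self ..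
  obtain ⟨y1, y2, y3, -⟩ := iteratedDeriv_jetPoly p.1 p.2 m c d 0
  rw [← hy] at y1 y2 y3
  have hρ1 := iteratedDeriv_one_along hV hp (hρ.of_le (by norm_num)) (hyc.of_le (by norm_num)) hyp
  have hψ1 := iteratedDeriv_one_along hV hp (hψ.of_le (by norm_num)) (hyc.of_le (by norm_num)) hyp
  rw [y1] at hρ1 hψ1
  obtain ⟨w₁, w₂, w₃, h1, h2, h3, h4⟩ := h.exists_jet_three hV hρ hψ hyc hyp hp (by rwa [hρ1])
  rw [hρ1, hψ1] at h1
  rw [hρ1, hψ2 y (hyc.of_le (by norm_num)) hyp, hρ2 y (hyc.of_le (by norm_num)) hyp, y1, y2] at h2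
  rw [hρ1, hψ3 y hyc hyp, hρ3 y hyc hyp, hρ2 y (hyc.of_le (by norm_num)) hyp, y1, y2, y3] at h3
  refine ⟨w₁, w₂, w₃, h1, h2, h3, h4.mp ?_⟩
  rw [hE y hyc hyp, y1, y2, y3, hd]
  ring

theorem CarriesToLinearOn.partialY_fst_eq_zero_four (h : CarriesToLinearOn 4 F ρ ψ a b V)
    (hV : IsOpen V) (hF : ContDiffOn ℝ 3 F V)
    (hρ : ContDiffOn ℝ 4 ρ V) (hψ : ContDiffOn ℝ 4 ψ V) (hp : p ∈ V)
    (hJ : partialX ρ p * partialY ψ p - partialY ρ p * partialX ψ p ≠ 0) :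
    partialY ρ p = 0 := by
  obtain ⟨m, hm⟩ := exists_add_mul_ne_zero hJ
  obtain ⟨qE, s, hE⟩ := exists_chainExpr_four_jet hV hF hp
  obtain ⟨Aρ, Bρ, hρ2⟩ := exists_iteratedDeriv_two_along hV hp (hρ.of_le (by norm_num))
  obtain ⟨Aψ, Bψ, hψ2⟩ := exists_iteratedDeriv_two_along hV hp (hψ.of_le (by norm_num))
  obtain ⟨qρ, Kρ, hρ3⟩ := exists_iteratedDeriv_three_along hV hp (hρ.of_le (by norm_num))
  obtain ⟨qψ, Kψ, hψ3⟩ := exists_iteratedDeriv_three_along hV hp (hψ.of_le (by norm_num))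
  obtain ⟨Qρ, Sρ, Lρ, hρ4⟩ := exists_iteratedDeriv_four_along hV hp hρ
  obtain ⟨Qψ, Sψ, Lψ, hψ4⟩ := exists_iteratedDeriv_four_along hV hp hψ
  refine eq_zero_of_jets_four (s := partialY ψ p) hm
    (W₁ := partialX ψ p + partialY ψ p * m) (by convert hJ using 1; ring) (fun c d => ?_)
    (g := 4 * F p + p.2 * partialY F p) (q := qE m)
    (t := s + (10 * partialY F p + 3 * p.2 * partialY (partialY F) p) * m)
    (e₂ := Aψ + Bψ * m + partialY (partialY ψ) p * m ^ 2)
    (z₂ := Aρ + Bρ * m + partialY (partialY ρ) p * m ^ 2)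
    (e₃ := qψ m) (z₃ := qρ m) (L := Kψ + 3 * partialY (partialY ψ) p * m)
    (l := Kρ + 3 * partialY (partialY ρ) p * m)
    (e₄ := Qψ m) (z₄ := Qρ m) (S := Sψ m) (T := Sρ m)
    (P := 3 * partialY (partialY ψ) p) (R := 3 * partialY (partialY ρ) p)
    (K := Lψ + 4 * partialY (partialY ψ) p * m) (k := Lρ + 4 * partialY (partialY ρ) p * m)
    (a₀ := a 0 (ρ p) * ψ p + b (ρ p)) (a₁ := a 1 (ρ p)) (a₂ := a 2 (ρ p)) (a₃ := a 3 (ρ p))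
  set e := -((4 * F p + p.2 * partialY F p) * d
    + (s + (10 * partialY F p + 3 * p.2 * partialY (partialY F) p) * m) * c + qE m) with he
  set y := jetPoly p.1 p.2 m c d e with hy
  have hyc : ContDiffAt ℝ 4 y p.1 := (contDiff_jetPoly ..).contDiffAt
  have hyc2 := hyc.of_le (m := 2) (by norm_num)
  have hyc3 := hyc.of_le (m := 3) (by norm_num)
  have hyp : y p.1 = p.2 := jetPoly_self ..
  obtain ⟨y1, y2, y3, y4⟩ := iteratedDeriv_jetPoly p.1 p.2 m c d e
  rw [← hy] at y1 y2 y3 y4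
  have hρ1 := iteratedDeriv_one_along hV hp (hρ.of_le (by norm_num)) (hyc.of_le (by norm_num)) hyp
  have hψ1 := iteratedDeriv_one_along hV hp (hψ.of_le (by norm_num)) (hyc.of_le (by norm_num)) hyp
  rw [y1] at hρ1 hψ1
  obtain ⟨w₁, w₂, w₃, w₄, h1, h2, h3, h4, h5⟩ :=
    h.exists_jet_four hV hρ hψ hyc hyp hp (by rwa [hρ1])
  rw [hρ1, hψ1] at h1
  rw [hρ1, hψ2 y hyc2 hyp, hρ2 y hyc2 hyp, y1, y2] at h2
  rw [hρ1, hψ3 y hyc3 hyp, hρ3 y hyc3 hyp, hρ2 y hyc2 hyp, y1, y2, y3] at h3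
  rw [hρ1, hψ4 y hyc hyp, hρ4 y hyc hyp, hρ3 y hyc3 hyp, hρ2 y hyc2 hyp, y1, y2, y3, y4] at h4
  refine ⟨w₁, w₂, w₃, w₄, h1, h2, h3, h4, h5.mp ?_⟩
  rw [hE y hyc hyp, y1, y2, y3, y4, he]
  ring

end transformation

/-! ### The dependent variable transforms affinely: `ψ_yy = 0`, and superposition -/

section fibres
variable {g : ℝ × ℝ → ℝ} {V : Set (ℝ × ℝ)} {p : ℝ × ℝ}

theorem eq_of_partialY_eq_zero {x : ℝ} {S : Set ℝ} (hV : IsOpen V) (hg : ContDiffOn ℝ 1 g V)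
    (hS : IsOpen S) (hS' : IsPreconnected S) (hSV : ∀ y ∈ S, (x, y) ∈ V)
    (h0 : ∀ y ∈ S, partialY g (x, y) = 0) {y₁ y₂ : ℝ} (h₁ : y₁ ∈ S) (h₂ : y₂ ∈ S) :
    g (x, y₁) = g (x, y₂) :=
  hS.is_const_of_deriv_eq_zero (f := fun y => g (x, y)) hS'
    (fun y hy => (hasDerivAt_partialY (k := 0) hg hV
      (hSV y hy)).differentiableAt.differentiableWithinAt) h0 h₁ h₂

theorem mk_mem_ball_iff {x y ε : ℝ} :
    (x, y) ∈ Metric.ball p ε ↔ x ∈ Metric.ball p.1 ε ∧ y ∈ Metric.ball p.2 ε := by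
  rw [← ball_prod_same p.1 p.2 ε, Set.mem_prod]

theorem add_div_two_mem_ball {c ε y₁ y₂ : ℝ} (h₁ : y₁ ∈ Metric.ball c ε)
    (h₂ : y₂ ∈ Metric.ball c ε) : (y₁ + y₂) / 2 ∈ Metric.ball c ε := by
  rw [Real.ball_eq_Ioo, Set.mem_Ioo] at *
  constructor <;> linarith

/-- On a box where `∂g/∂y = 0`, the function `g` depends on `x` only. -/
theorem eq_of_mem_ball {ε : ℝ} (hV : IsOpen V) (hg : ContDiffOn ℝ 1 g V)
    (hε : Metric.ball p ε ⊆ V) (h0 : ∀ q ∈ Metric.ball p ε, partialY g q = 0) {x y₁ y₂ : ℝ}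
    (h₁ : (x, y₁) ∈ Metric.ball p ε) (h₂ : (x, y₂) ∈ Metric.ball p ε) : g (x, y₁) = g (x, y₂) := by
  have hx := (mk_mem_ball_iff.mp h₁).1
  exact eq_of_partialY_eq_zero hV hg Metric.isOpen_ball (convex_ball p.2 ε).isPreconnected
    (fun y hy => hε (mk_mem_ball_iff.mpr ⟨hx, hy⟩))
    (fun y hy => h0 _ (mk_mem_ball_iff.mpr ⟨hx, hy⟩))
    (mk_mem_ball_iff.mp h₁).2 (mk_mem_ball_iff.mp h₂).2

/-- On a box where `∂²g/∂y² = 0`, the function `g` is affine in `y`. -/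
theorem midpoint_of_mem_ball {ε : ℝ} (hV : IsOpen V) (hg : ContDiffOn ℝ 2 g V)
    (hε : Metric.ball p ε ⊆ V) (h0 : ∀ q ∈ Metric.ball p ε, partialY (partialY g) q = 0)
    {x y₁ y₂ : ℝ} (h₁ : (x, y₁) ∈ Metric.ball p ε) (h₂ : (x, y₂) ∈ Metric.ball p ε) :
    g (x, (y₁ + y₂) / 2) = (g (x, y₁) + g (x, y₂)) / 2 := by
  have hx := (mk_mem_ball_iff.mp h₁).1
  have hmem : ∀ y ∈ Metric.ball p.2 ε, (x, y) ∈ Metric.ball p ε :=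
    fun y hy => mk_mem_ball_iff.mpr ⟨hx, hy⟩
  have hconst := fun y hy => eq_of_mem_ball hV (contDiffOn_partialY (k := 1) hg hV) hε h0
    (hmem y hy) h₁
  have hd : ∀ y ∈ Metric.ball p.2 ε,
      HasDerivAt (fun y => g (x, y) - partialY g (x, y₁) * y) 0 y := by
    intro y hy
    have h := (hasDerivAt_partialY (k := 1) hg hV (hε (hmem y hy))).sub
      ((hasDerivAt_id y).const_mul (partialY g (x, y₁)))
    rw [hconst y hy, mul_one, sub_self] at h
    exact h
  have key := fun y y' hy hy' => Metric.isOpen_ball.is_const_of_deriv_eq_zero (x := y) (y := y')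
    (convex_ball p.2 ε).isPreconnected
    (fun y hy => (hd y hy).differentiableAt.differentiableWithinAt) (fun y hy => (hd y hy).deriv)
    hy hy'
  have hy₁ := (mk_mem_ball_iff.mp h₁).2
  have hy₂ := (mk_mem_ball_iff.mp h₂).2
  have hm := add_div_two_mem_ball hy₁ hy₂
  have k1 := key _ _ hm hy₁
  have k2 := key _ _ hm hy₂
  linear_combination (k1 + k2) / 2

end fibres

section affine
variable {F ρ ψ : ℝ × ℝ → ℝ} {V : Set (ℝ × ℝ)} {p : ℝ × ℝ} {a : ℕ → ℝ → ℝ} {b : ℝ → ℝ}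

theorem eventuallyEq_along_of_fibre {y : ℝ → ℝ} (hfib : ∀ᶠ q in 𝓝 p, ρ q = ρ (q.1, p.2))
    (hy : ContinuousAt y p.1) (hyp : y p.1 = p.2) :
    (fun x => ρ (x, y x)) =ᶠ[𝓝 p.1] fun x => ρ (x, p.2) := by
  have : Tendsto (fun x => (x, y x)) (𝓝 p.1) (𝓝 p) := by
    have := (continuousAt_id (x := p.1)).prodMk hy
    rw [ContinuousAt, hyp] at this
    exact this
  exact this.eventually hfib

/-- The elimination behind `ψ_yy = 0` for third order, once `z` depends on `x` only. Here
`P = ψ_yy`, `m = y'` and `c = y''`; the coefficient of `y''` in the transformed equation must not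
depend on `y'`, but it is affine in `y'` with slope `3 P`. -/
theorem eq_zero_of_fibred_jets_three {W e₂ e₃ q : ℝ → ℝ} {D s z₂ z₃ K P g a₀ a₁ a₂ : ℝ}
    (hD : D ≠ 0)
    (H : ∀ m c : ℝ, ∃ w₁ w₂ w₃ : ℝ, W m = w₁ * D ∧
      e₂ m + s * c = w₂ * D ^ 2 + w₁ * z₂ ∧
      e₃ m + (K + 3 * P * m) * c + s * -(g * c + q m) = w₃ * D ^ 3 + 3 * w₂ * D * z₂ + w₁ * z₃ ∧
      w₃ + a₂ * w₂ + a₁ * w₁ + a₀ = 0) : P = 0 := by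
  have key : ∀ m : ℝ, D ^ 2 * (K + 3 * P * m - s * g) = - a₂ * s * D ^ 3 + 3 * D * z₂ * s := by
    intro m
    obtain ⟨w₁, u₂, u₃, h1, h2, h3, h4⟩ := H m 0
    obtain ⟨w₁', v₂, v₃, k1, k2, k3, k4⟩ := H m 1
    obtain rfl : w₁' = w₁ := mul_right_cancel₀ hD (k1.symm.trans h1)
    linear_combination D ^ 2 * (k3 - h3) - (3 * D * z₂ - a₂ * D ^ 3) * (k2 - h2)
      + D ^ 5 * (k4 - h4)
  have h : D ^ 2 * (3 * P) = 0 := by linear_combination key 1 - key 0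
  have := (mul_eq_zero.mp h).resolve_left (pow_ne_zero 2 hD)
  linarith

/-- The elimination behind `ψ_yy = 0` for fourth order, once `z` depends on `x` only. Here
`P = ψ_yy`, `m = y'`, `y'' = 0` and `d = y'''`; the coefficient of `y'''` in the transformed
equation must not depend on `y'`, but it is affine in `y'` with slope `4 P`. -/
theorem eq_zero_of_fibred_jets_four {W e₂ e₃ e₄ q : ℝ → ℝ}
    {D s z₂ z₃ z₄ K P g a₀ a₁ a₂ a₃ : ℝ} (hD : D ≠ 0)
    (H : ∀ m d : ℝ, ∃ w₁ w₂ w₃ w₄ : ℝ, W m = w₁ * D ∧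
      e₂ m = w₂ * D ^ 2 + w₁ * z₂ ∧
      e₃ m + s * d = w₃ * D ^ 3 + 3 * w₂ * D * z₂ + w₁ * z₃ ∧
      e₄ m + (K + 4 * P * m) * d + s * -(g * d + q m) = w₄ * D ^ 4 + 6 * w₃ * D ^ 2 * z₂
        + w₂ * (3 * z₂ ^ 2 + 4 * D * z₃) + w₁ * z₄ ∧
      w₄ + a₃ * w₃ + a₂ * w₂ + a₁ * w₁ + a₀ = 0) : P = 0 := by
  have key : ∀ m : ℝ, D ^ 3 * (K + 4 * P * m - s * g)
      = - a₃ * s * D ^ 4 + 6 * D ^ 2 * z₂ * s := by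
    intro m
    obtain ⟨w₁, u₂, u₃, u₄, h1, h2, h3, h4, h5⟩ := H m 0
    obtain ⟨w₁', v₂, v₃, v₄, k1, k2, k3, k4, k5⟩ := H m 1
    obtain rfl : w₁' = w₁ := mul_right_cancel₀ hD (k1.symm.trans h1)
    obtain rfl : v₂ = u₂ := by
      refine mul_right_cancel₀ (pow_ne_zero 2 hD) ?_
      linear_combination h2 - k2
    linear_combination D ^ 3 * (k4 - h4) - (6 * D ^ 2 * z₂ - a₃ * D ^ 4) * (k3 - h3)
      + D ^ 7 * (k5 - h5)
  have h : D ^ 3 * (4 * P) = 0 := by linear_combination key 1 - key 0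
  have := (mul_eq_zero.mp h).resolve_left (pow_ne_zero 3 hD)
  linarith

theorem CarriesToLinearOn.partialY_partialY_snd_eq_zero_three
    (h : CarriesToLinearOn 3 F ρ ψ a b V) (hV : IsOpen V) (hF : ContDiffOn ℝ 2 F V)
    (hρ : ContDiffOn ℝ 3 ρ V) (hψ : ContDiffOn ℝ 3 ψ V) (hp : p ∈ V)
    (hfib : ∀ᶠ q in 𝓝 p, ρ q = ρ (q.1, p.2)) (hρx : partialX ρ p ≠ 0) :
    partialY (partialY ψ) p = 0 := by
  obtain ⟨A, B, hE⟩ := exists_chainExpr_three_jet hV hF hp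
  obtain ⟨Aψ, Bψ, hψ2⟩ := exists_iteratedDeriv_two_along hV hp (hψ.of_le (by norm_num))
  obtain ⟨qψ, Kψ, hψ3⟩ := exists_iteratedDeriv_three_along hV hp hψ
  have hR1 : iteratedDeriv 1 (fun x => ρ (x, p.2)) p.1 = partialX ρ p := by
    rw [iteratedDeriv_one, partialX]
  refine eq_zero_of_fibred_jets_three (s := partialY ψ p) hρx
    (W := fun m => partialX ψ p + partialY ψ p * m) (g := 3 * F p + p.2 * partialY F p)
    (q := fun m => A + B * m + (3 * partialY F p + p.2 * partialY (partialY F) p) * m ^ 2)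
    (e₂ := fun m => Aψ + Bψ * m + partialY (partialY ψ) p * m ^ 2)
    (z₂ := iteratedDeriv 2 (fun x => ρ (x, p.2)) p.1)
    (z₃ := iteratedDeriv 3 (fun x => ρ (x, p.2)) p.1)
    (e₃ := qψ) (K := Kψ)
    (a₀ := a 0 (ρ p) * ψ p + b (ρ p)) (a₁ := a 1 (ρ p)) (a₂ := a 2 (ρ p)) (fun m c => ?_)
  set d := -((3 * F p + p.2 * partialY F p) * c
    + (A + B * m + (3 * partialY F p + p.2 * partialY (partialY F) p) * m ^ 2)) with hd
  set y := jetPoly p.1 p.2 m c d 0 with hy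
  have hyc : ContDiffAt ℝ 3 y p.1 := (contDiff_jetPoly ..).contDiffAt
  have hyp : y p.1 = p.2 := jetPoly_self ..
  obtain ⟨y1, y2, y3, -⟩ := iteratedDeriv_jetPoly p.1 p.2 m c d 0
  rw [← hy] at y1 y2 y3
  have hψ1 := iteratedDeriv_one_along hV hp (hψ.of_le (by norm_num)) (hyc.of_le (by norm_num)) hyp
  have hR := eventuallyEq_along_of_fibre hfib hyc.continuousAt hyp
  obtain ⟨w₁, w₂, w₃, h1, h2, h3, h4⟩ := h.exists_jet_three hV hρ hψ hyc hyp hp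
    (by rwa [hR.iteratedDeriv_eq, hR1])
  rw [hR.iteratedDeriv_eq 1, hR1] at h1 h2 h3
  rw [hR.iteratedDeriv_eq 2] at h2 h3
  rw [hR.iteratedDeriv_eq 3, hψ3 y hyc hyp, y1, y2, y3] at h3
  rw [hψ1, y1] at h1
  rw [hψ2 y (hyc.of_le (by norm_num)) hyp, y1, y2] at h2
  refine ⟨w₁, w₂, w₃, h1, h2, h3, h4.mp ?_⟩
  rw [hE y hyc hyp, y1, y2, y3, hd]
  ring

theorem CarriesToLinearOn.partialY_partialY_snd_eq_zero_four
    (h : CarriesToLinearOn 4 F ρ ψ a b V) (hV : IsOpen V) (hF : ContDiffOn ℝ 3 F V)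
    (hρ : ContDiffOn ℝ 4 ρ V) (hψ : ContDiffOn ℝ 4 ψ V) (hp : p ∈ V)
    (hfib : ∀ᶠ q in 𝓝 p, ρ q = ρ (q.1, p.2)) (hρx : partialX ρ p ≠ 0) :
    partialY (partialY ψ) p = 0 := by
  obtain ⟨qE, s, hE⟩ := exists_chainExpr_four_jet hV hF hp
  obtain ⟨Aψ, Bψ, hψ2⟩ := exists_iteratedDeriv_two_along hV hp (hψ.of_le (by norm_num))
  obtain ⟨qψ, Kψ, hψ3⟩ := exists_iteratedDeriv_three_along hV hp (hψ.of_le (by norm_num))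
  obtain ⟨Qψ, Sψ, Lψ, hψ4⟩ := exists_iteratedDeriv_four_along hV hp hψ
  have hR1 : iteratedDeriv 1 (fun x => ρ (x, p.2)) p.1 = partialX ρ p := by
    rw [iteratedDeriv_one, partialX]
  refine eq_zero_of_fibred_jets_four (s := partialY ψ p) hρx
    (W := fun m => partialX ψ p + partialY ψ p * m) (g := 4 * F p + p.2 * partialY F p) (q := qE)
    (e₂ := fun m => Aψ + Bψ * m + partialY (partialY ψ) p * m ^ 2)
    (z₂ := iteratedDeriv 2 (fun x => ρ (x, p.2)) p.1)
    (z₃ := iteratedDeriv 3 (fun x => ρ (x, p.2)) p.1)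
    (z₄ := iteratedDeriv 4 (fun x => ρ (x, p.2)) p.1)
    (e₃ := qψ) (e₄ := Qψ) (K := Lψ)
    (a₀ := a 0 (ρ p) * ψ p + b (ρ p)) (a₁ := a 1 (ρ p)) (a₂ := a 2 (ρ p)) (a₃ := a 3 (ρ p))
    (fun m d => ?_)
  set e := -((4 * F p + p.2 * partialY F p) * d + qE m) with he
  set y := jetPoly p.1 p.2 m 0 d e with hy
  have hyc : ContDiffAt ℝ 4 y p.1 := (contDiff_jetPoly ..).contDiffAt
  have hyp : y p.1 = p.2 := jetPoly_self ..
  obtain ⟨y1, y2, y3, y4⟩ := iteratedDeriv_jetPoly p.1 p.2 m 0 d e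
  rw [← hy] at y1 y2 y3 y4
  have hψ1 := iteratedDeriv_one_along hV hp (hψ.of_le (by norm_num)) (hyc.of_le (by norm_num)) hyp
  have hR := eventuallyEq_along_of_fibre hfib hyc.continuousAt hyp
  obtain ⟨w₁, w₂, w₃, w₄, h1, h2, h3, h4, h5⟩ := h.exists_jet_four hV hρ hψ hyc hyp hp
    (by rwa [hR.iteratedDeriv_eq, hR1])
  rw [hR.iteratedDeriv_eq 1, hR1] at h1 h2 h3 h4
  rw [hR.iteratedDeriv_eq 2] at h2 h3 h4
  rw [hR.iteratedDeriv_eq 3] at h3 h4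
  rw [hψ1, y1] at h1
  rw [hψ2 y (hyc.of_le (by norm_num)) hyp, y1, y2, mul_zero, add_zero] at h2
  rw [hψ3 y (hyc.of_le (by norm_num)) hyp, y1, y2, y3, mul_zero, add_zero] at h3
  rw [hR.iteratedDeriv_eq 4, hψ4 y hyc hyp, y1, y2, y3, y4] at h4
  refine ⟨w₁, w₂, w₃, w₄, h1, h2, h3, ?_, h5.mp ?_⟩
  · linear_combination h4
  · rw [hE y hyc hyp, y1, y2, y3, y4, he]
    ring

theorem linearExpr_midpoint {n : ℕ} {w₁ w₂ : ℝ → ℝ} {z : ℝ} (h₁ : ContDiffAt ℝ n w₁ z)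
    (h₂ : ContDiffAt ℝ n w₂ z) :
    linearExpr n a b ((1 / 2 : ℝ) • (w₁ + w₂)) z
      = (linearExpr n a b w₁ z + linearExpr n a b w₂ z) / 2 := by
  have hk : ∀ k ≤ n, iteratedDeriv k ((1 / 2 : ℝ) • (w₁ + w₂)) z
      = (iteratedDeriv k w₁ z + iteratedDeriv k w₂ z) / 2 := by
    intro k hk
    have h₁ := h₁.of_le (m := k) (by exact_mod_cast hk)
    have h₂ := h₂.of_le (m := k) (by exact_mod_cast hk)
    have h₃ : ContDiffAt ℝ k (w₁ + w₂) z := h₁.add h₂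
    rw [iteratedDeriv_const_smul h₃, iteratedDeriv_add h₁ h₂, smul_eq_mul]
    ring
  simp only [linearExpr]
  rw [hk n le_rfl, Finset.sum_congr rfl fun k h => by rw [hk k (Finset.mem_range.mp h).le]]
  have : ∑ k ∈ Finset.range n, a k z * ((iteratedDeriv k w₁ z + iteratedDeriv k w₂ z) / 2)
      = (∑ k ∈ Finset.range n, a k z * iteratedDeriv k w₁ z
        + ∑ k ∈ Finset.range n, a k z * iteratedDeriv k w₂ z) / 2 := by
    rw [← Finset.sum_add_distrib, Finset.sum_div]
    exact Finset.sum_congr rfl fun k _ => by ring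
  rw [this]
  ring

/-- Superposition: if `z = ρ(x)` and `w` is affine in `y`, then midpoints of solution jets of
`Ω^n[y] = 0` over the same `x` are again solution jets, since midpoints of solutions of the linear
equation are solutions. -/
theorem CarriesToLinearOn.chainExpr_midpoint {n : ℕ} (hn : n ≠ 0)
    (h : CarriesToLinearOn n F ρ ψ a b V) (hV : IsOpen V)
    (hρ : ContDiffOn ℝ n ρ V) (hψ : ContDiffOn ℝ n ψ V) {ε : ℝ} (hε : Metric.ball p ε ⊆ V)
    (hρf : ∀ x y₁ y₂, (x, y₁) ∈ Metric.ball p ε → (x, y₂) ∈ Metric.ball p ε →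
      ρ (x, y₁) = ρ (x, y₂))
    (hψf : ∀ x y₁ y₂, (x, y₁) ∈ Metric.ball p ε → (x, y₂) ∈ Metric.ball p ε →
      ψ (x, (y₁ + y₂) / 2) = (ψ (x, y₁) + ψ (x, y₂)) / 2)
    (hρx : partialX ρ p ≠ 0) {y₁ y₂ : ℝ → ℝ} (hy₁ : ContDiffAt ℝ n y₁ p.1)
    (hy₂ : ContDiffAt ℝ n y₂ p.1) (hp₁ : y₁ p.1 ∈ Metric.ball p.2 ε)
    (hp₂ : y₂ p.1 ∈ Metric.ball p.2 ε) (h₁ : chainExpr F n y₁ p.1 = 0)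
    (h₂ : chainExpr F n y₂ p.1 = 0) :
    chainExpr F n (fun x => (y₁ x + y₂ x) / 2) p.1 = 0 := by
  have hε0 : 0 < ε := Metric.nonempty_ball.mp ⟨_, hp₁⟩
  have hmid : ∀ x y₁ y₂, (x, y₁) ∈ Metric.ball p ε → (x, y₂) ∈ Metric.ball p ε →
      (x, (y₁ + y₂) / 2) ∈ Metric.ball p ε := by
    intro x y₁ y₂ h₁ h₂
    exact mk_mem_ball_iff.mpr ⟨(mk_mem_ball_iff.mp h₁).1,
      add_div_two_mem_ball (mk_mem_ball_iff.mp h₁).2 (mk_mem_ball_iff.mp h₂).2⟩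
  have hcen : ∀ x y, (x, y) ∈ Metric.ball p ε → (x, p.2) ∈ Metric.ball p ε := fun x y hxy =>
    mk_mem_ball_iff.mpr ⟨(mk_mem_ball_iff.mp hxy).1, Metric.mem_ball_self hε0⟩
  have hx₀ := Metric.mem_ball_self (x := p.1) hε0
  -- Along any curve with values in the box, `z` is one and the same function of `x`.
  have hR : ∀ y : ℝ → ℝ, ContinuousAt y p.1 → (p.1, y p.1) ∈ Metric.ball p ε →
      (fun x => ρ (x, y x)) =ᶠ[𝓝 p.1] fun x => ρ (x, p.2) := by
    intro y hy hyp
    filter_upwards [eventually_graph_mem Metric.isOpen_ball hyp hy] with x hx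
    exact hρf _ _ _ hx (hcen _ _ hx)
  have hRd : ∀ y : ℝ → ℝ, ContinuousAt y p.1 → (p.1, y p.1) ∈ Metric.ball p ε →
      deriv (fun x => ρ (x, y x)) p.1 ≠ 0 := by
    intro y hy hyp
    rw [(hR y hy hyp).deriv_eq]
    exact hρx
  have hB₁ : (p.1, y₁ p.1) ∈ Metric.ball p ε := mk_mem_ball_iff.mpr ⟨hx₀, hp₁⟩
  have hB₂ : (p.1, y₂ p.1) ∈ Metric.ball p ε := mk_mem_ball_iff.mpr ⟨hx₀, hp₂⟩
  have hB := hmid _ _ _ hB₁ hB₂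
  have hd₁ := hRd y₁ hy₁.continuousAt hB₁
  have hd₂ := hRd y₂ hy₂.continuousAt hB₂
  have hy : ContDiffAt ℝ n (fun x => (y₁ x + y₂ x) / 2) p.1 := (hy₁.add hy₂).div_const 2
  obtain ⟨w₁, hw₁, hwZ₁⟩ := exists_comp_eq_of_deriv_ne_zero hn
    (contDiffAt_along hρ hV (hε hB₁) hy₁) (contDiffAt_along hψ hV (hε hB₁) hy₁) hd₁
  obtain ⟨w₂, hw₂, hwZ₂⟩ := exists_comp_eq_of_deriv_ne_zero hn
    (contDiffAt_along hρ hV (hε hB₂) hy₂) (contDiffAt_along hψ hV (hε hB₂) hy₂) hd₂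
  have e₁ : ρ (p.1, y₁ p.1) = ρ (p.1, (y₁ p.1 + y₂ p.1) / 2) := hρf _ _ _ hB₁ hB
  have e₂ : ρ (p.1, y₂ p.1) = ρ (p.1, (y₁ p.1 + y₂ p.1) / 2) := hρf _ _ _ hB₂ hB
  have l₁ := (h p.1 y₁ w₁ hy₁ (hε hB₁) hd₁ hw₁ hwZ₁).mp h₁
  have l₂ := (h p.1 y₂ w₂ hy₂ (hε hB₂) hd₂ hw₂ hwZ₂).mp h₂
  simp only [e₁, e₂] at hw₁ hw₂ l₁ l₂
  refine (h p.1 _ ((1 / 2 : ℝ) • (w₁ + w₂)) hy (hε hB) (hRd _ hy.continuousAt hB)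
    (ContDiffAt.const_smul (1 / 2 : ℝ) (hw₁.add hw₂)) ?_).mpr ?_
  · filter_upwards [hwZ₁, hwZ₂,
      eventually_graph_mem Metric.isOpen_ball hB₁ hy₁.continuousAt,
      eventually_graph_mem Metric.isOpen_ball hB₂ hy₂.continuousAt] with x k₁ k₂ m₁ m₂
    have m := hmid _ _ _ m₁ m₂
    rw [hρf _ _ _ m₁ m] at k₁
    rw [hρf _ _ _ m₂ m] at k₂
    rw [hψf _ _ _ m₁ m₂, ← k₁, ← k₂]
    simp only [Pi.smul_apply, Pi.add_apply, smul_eq_mul]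
    ring
  · rw [linearExpr_midpoint hw₁ hw₂, l₁, l₂]
    norm_num

end affine

/-! ### Superposition forces `F_y = 0` -/

section nonlinear
variable {F ρ ψ : ℝ × ℝ → ℝ} {V : Set (ℝ × ℝ)} {p : ℝ × ℝ} {a : ℕ → ℝ → ℝ} {b : ℝ → ℝ}

theorem jetPoly_midpoint (x₀ m₀ m₁ m₂ m₃ m₄ k₀ k₁ k₂ k₃ k₄ : ℝ) :
    (fun x => (jetPoly x₀ m₀ m₁ m₂ m₃ m₄ x + jetPoly x₀ k₀ k₁ k₂ k₃ k₄ x) / 2)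
      = jetPoly x₀ ((m₀ + k₀) / 2) ((m₁ + k₁) / 2) ((m₂ + k₂) / 2) ((m₃ + k₃) / 2)
        ((m₄ + k₄) / 2) := by
  ext x
  simp only [jetPoly]
  ring

theorem eventually_reflection_mem_ball {c ε : ℝ} (hε : 0 < ε) :
    ∀ᶠ t in 𝓝 c, t ∈ Metric.ball c ε ∧ 2 * c - t ∈ Metric.ball c ε := by
  filter_upwards [Metric.ball_mem_nhds c hε] with t ht
  refine ⟨ht, ?_⟩
  rw [Real.ball_eq_Ioo, Set.mem_Ioo] at *
  constructor <;> linarith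

/-- A function whose value at the midpoint of any two points is its value at the first of them
has derivative zero. -/
theorem eq_zero_of_midpoint_eq_left {G : ℝ → ℝ} {c ε G' : ℝ} (hε : 0 < ε)
    (hG : ∀ t₁ ∈ Metric.ball c ε, ∀ t₂ ∈ Metric.ball c ε, G ((t₁ + t₂) / 2) = G t₁)
    (hd : HasDerivAt G G' c) : G' = 0 := by
  have h : G =ᶠ[𝓝 c] fun _ => G c := by
    filter_upwards [eventually_reflection_mem_ball hε] with t ht
    rw [← hG t ht.1 _ ht.2]
    congr 1
    ring
  exact hd.unique ((hasDerivAt_const c (G c)).congr_of_eventuallyEq h)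

/-- If the solution jets of the third-order equation are closed under midpoints, then `F_y = 0`:
the coefficient `3 F_y + y F_yy` of `y'²` vanishes, and the coefficient `3 F + y F_y` of `y''` is
independent of `y`, so that `4 F_y + y F_yy = 0`. -/
theorem partialY_eq_zero_of_midpoint_three {ε : ℝ} (hε : 0 < ε) (hV : IsOpen V)
    (hεV : Metric.ball p ε ⊆ V) (hF : ContDiffOn ℝ 2 F V)
    (H : ∀ y₁ y₂ : ℝ → ℝ, ContDiffAt ℝ 3 y₁ p.1 → ContDiffAt ℝ 3 y₂ p.1 →
      y₁ p.1 ∈ Metric.ball p.2 ε → y₂ p.1 ∈ Metric.ball p.2 ε →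
      chainExpr F 3 y₁ p.1 = 0 → chainExpr F 3 y₂ p.1 = 0 →
      chainExpr F 3 (fun x => (y₁ x + y₂ x) / 2) p.1 = 0) : partialY F p = 0 := by
  have hmem : ∀ t ∈ Metric.ball p.2 ε, (p.1, t) ∈ V := fun t ht =>
    hεV (mk_mem_ball_iff.mpr ⟨Metric.mem_ball_self hε, ht⟩)
  have hp : p ∈ V := hεV (Metric.mem_ball_self hε)
  have hjet : ∀ t ∈ Metric.ball p.2 ε, ∃ α β : ℝ, ∀ m c d : ℝ,
      chainExpr F 3 (jetPoly p.1 t m c d 0) p.1 = d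
        + (3 * F (p.1, t) + t * partialY F (p.1, t)) * c
        + (α + β * m + (3 * partialY F (p.1, t) + t * partialY (partialY F) (p.1, t)) * m ^ 2) := by
    intro t ht
    obtain ⟨α, β, h⟩ := exists_chainExpr_three_jet hV hF (hmem t ht)
    refine ⟨α, β, fun m c d => ?_⟩
    obtain ⟨y1, y2, y3, -⟩ := iteratedDeriv_jetPoly p.1 t m c d 0
    rw [h _ (contDiff_jetPoly ..).contDiffAt (jetPoly_self ..), y1, y2, y3]
  have H' : ∀ t₁ m₁ c₁ d₁ t₂ m₂ c₂ d₂ : ℝ, t₁ ∈ Metric.ball p.2 ε → t₂ ∈ Metric.ball p.2 ε →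
      chainExpr F 3 (jetPoly p.1 t₁ m₁ c₁ d₁ 0) p.1 = 0 →
      chainExpr F 3 (jetPoly p.1 t₂ m₂ c₂ d₂ 0) p.1 = 0 →
      chainExpr F 3 (jetPoly p.1 ((t₁ + t₂) / 2) ((m₁ + m₂) / 2) ((c₁ + c₂) / 2)
        ((d₁ + d₂) / 2) 0) p.1 = 0 := by
    intro t₁ m₁ c₁ d₁ t₂ m₂ c₂ d₂ ht₁ ht₂ h₁ h₂
    have := H _ _ (contDiff_jetPoly ..).contDiffAt (contDiff_jetPoly ..).contDiffAt
      (by rwa [jetPoly_self]) (by rwa [jetPoly_self]) h₁ h₂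
    rwa [jetPoly_midpoint, add_zero, zero_div] at this
  -- The left-hand side has no term in `(y')²`.
  have hγ : 3 * partialY F p + p.2 * partialY (partialY F) p = 0 := by
    have ht := Metric.mem_ball_self (x := p.2) hε
    obtain ⟨α, β, h⟩ := hjet _ ht
    set γ := 3 * partialY F (p.1, p.2) + p.2 * partialY (partialY F) (p.1, p.2)
    have := H' p.2 1 0 (-(α + β + γ)) p.2 (-1) 0 (-(α - β + γ)) ht ht
      (by rw [h]; ring) (by rw [h]; ring)
    rw [add_self_div_two, h] at this
    linear_combination -this
  -- The coefficient of `y''` does not depend on `y`.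
  have hG : 4 * partialY F p + p.2 * partialY (partialY F) p = 0 := by
    refine eq_zero_of_midpoint_eq_left (c := p.2) (ε := ε)
      (G := fun t => 3 * F (p.1, t) + t * partialY F (p.1, t)) hε ?_ ?_
    · intro t₁ ht₁ t₂ ht₂
      obtain ⟨α₁, β₁, h₁⟩ := hjet _ ht₁
      obtain ⟨α₂, β₂, h₂⟩ := hjet _ ht₂
      obtain ⟨α, β, h⟩ := hjet _ (add_div_two_mem_ball ht₁ ht₂)
      have k : ∀ c : ℝ, _ := fun c => H' t₁ 0 c
        (-((3 * F (p.1, t₁) + t₁ * partialY F (p.1, t₁)) * c + α₁)) t₂ 0 0 (-α₂) ht₁ ht₂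
        (by rw [h₁]; ring) (by rw [h₂]; ring)
      have k0 := k 0
      have k1 := k 1
      rw [h] at k0 k1
      linear_combination 2 * (k1 - k0)
    · have h := ((hasDerivAt_partialY (k := 1) hF hV hp).const_mul 3).add
        ((hasDerivAt_id p.2).mul
          (hasDerivAt_partialY (k := 0) (contDiffOn_partialY (k := 1) hF hV) hV hp))
      refine h.congr_deriv ?_
      simp only [id]
      ring
  linarith

/-- If the solution jets of the fourth-order equation are closed under midpoints, then `F_y = 0`:
the coefficient `10 F_y + 3 y F_yy` of `y' y''` vanishes, and the coefficient `4 F + y F_y` of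
`y'''` is independent of `y`, so that `5 F_y + y F_yy = 0`. -/
theorem partialY_eq_zero_of_midpoint_four {ε : ℝ} (hε : 0 < ε) (hV : IsOpen V)
    (hεV : Metric.ball p ε ⊆ V) (hF : ContDiffOn ℝ 3 F V)
    (H : ∀ y₁ y₂ : ℝ → ℝ, ContDiffAt ℝ 4 y₁ p.1 → ContDiffAt ℝ 4 y₂ p.1 →
      y₁ p.1 ∈ Metric.ball p.2 ε → y₂ p.1 ∈ Metric.ball p.2 ε →
      chainExpr F 4 y₁ p.1 = 0 → chainExpr F 4 y₂ p.1 = 0 →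
      chainExpr F 4 (fun x => (y₁ x + y₂ x) / 2) p.1 = 0) : partialY F p = 0 := by
  have hmem : ∀ t ∈ Metric.ball p.2 ε, (p.1, t) ∈ V := fun t ht =>
    hεV (mk_mem_ball_iff.mpr ⟨Metric.mem_ball_self hε, ht⟩)
  have hp : p ∈ V := hεV (Metric.mem_ball_self hε)
  have hjet : ∀ t ∈ Metric.ball p.2 ε, ∃ (q : ℝ → ℝ) (s : ℝ), ∀ m c d e : ℝ,
      chainExpr F 4 (jetPoly p.1 t m c d e) p.1 = e
        + (4 * F (p.1, t) + t * partialY F (p.1, t)) * d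
        + (s + (10 * partialY F (p.1, t) + 3 * t * partialY (partialY F) (p.1, t)) * m) * c
        + q m := by
    intro t ht
    obtain ⟨q, s, h⟩ := exists_chainExpr_four_jet hV hF (hmem t ht)
    refine ⟨q, s, fun m c d e => ?_⟩
    obtain ⟨y1, y2, y3, y4⟩ := iteratedDeriv_jetPoly p.1 t m c d e
    rw [h _ (contDiff_jetPoly ..).contDiffAt (jetPoly_self ..), y1, y2, y3, y4]
  have H' : ∀ t₁ m₁ c₁ d₁ e₁ t₂ m₂ c₂ d₂ e₂ : ℝ,
      t₁ ∈ Metric.ball p.2 ε → t₂ ∈ Metric.ball p.2 ε →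
      chainExpr F 4 (jetPoly p.1 t₁ m₁ c₁ d₁ e₁) p.1 = 0 →
      chainExpr F 4 (jetPoly p.1 t₂ m₂ c₂ d₂ e₂) p.1 = 0 →
      chainExpr F 4 (jetPoly p.1 ((t₁ + t₂) / 2) ((m₁ + m₂) / 2) ((c₁ + c₂) / 2)
        ((d₁ + d₂) / 2) ((e₁ + e₂) / 2)) p.1 = 0 := by
    intro t₁ m₁ c₁ d₁ e₁ t₂ m₂ c₂ d₂ e₂ ht₁ ht₂ h₁ h₂
    have := H _ _ (contDiff_jetPoly ..).contDiffAt (contDiff_jetPoly ..).contDiffAt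
      (by rwa [jetPoly_self]) (by rwa [jetPoly_self]) h₁ h₂
    rwa [jetPoly_midpoint] at this
  -- The left-hand side has no term in `y' y''`: the diagonals of the unit square of the
  -- `(y', y'')`-plane have the same midpoint.
  have hγ : 10 * partialY F p + 3 * p.2 * partialY (partialY F) p = 0 := by
    have ht := Metric.mem_ball_self (x := p.2) hε
    obtain ⟨q, s, h⟩ := hjet _ ht
    set γ := 10 * partialY F (p.1, p.2) + 3 * p.2 * partialY (partialY F) (p.1, p.2)
    have k1 := H' p.2 1 0 0 (-q 1) p.2 0 1 0 (-(s + q 0)) ht ht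
      (by rw [h]; ring) (by rw [h]; ring)
    have k2 := H' p.2 1 1 0 (-(s + γ + q 1)) p.2 0 0 0 (-q 0) ht ht
      (by rw [h]; ring) (by rw [h]; ring)
    rw [add_self_div_two, h] at k1 k2
    rw [add_zero, zero_add] at k1
    rw [add_zero] at k2
    linear_combination 2 * (k1 - k2)
  -- The coefficient of `y'''` does not depend on `y`.
  have hG : 5 * partialY F p + p.2 * partialY (partialY F) p = 0 := by
    refine eq_zero_of_midpoint_eq_left (c := p.2) (ε := ε)
      (G := fun t => 4 * F (p.1, t) + t * partialY F (p.1, t)) hε ?_ ?_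
    · intro t₁ ht₁ t₂ ht₂
      obtain ⟨q₁, s₁, h₁⟩ := hjet _ ht₁
      obtain ⟨q₂, s₂, h₂⟩ := hjet _ ht₂
      obtain ⟨q, s, h⟩ := hjet _ (add_div_two_mem_ball ht₁ ht₂)
      have k : ∀ d : ℝ, _ := fun d => H' t₁ 0 0 d
        (-((4 * F (p.1, t₁) + t₁ * partialY F (p.1, t₁)) * d + q₁ 0)) t₂ 0 0 0 (-q₂ 0) ht₁ ht₂
        (by rw [h₁]; ring) (by rw [h₂]; ring)
      have k0 := k 0
      have k1 := k 1
      rw [h] at k0 k1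
      linear_combination 2 * (k1 - k0)
    · have h := ((hasDerivAt_partialY (k := 2) hF hV hp).const_mul 4).add
        ((hasDerivAt_id p.2).mul
          (hasDerivAt_partialY (k := 1) (contDiffOn_partialY (k := 2) hF hV) hV hp))
      refine h.congr_deriv ?_
      simp only [id]
      ring
  linarith

theorem CarriesToLinearOn.partialY_eq_zero {n : ℕ} (hn : n = 3 ∨ n = 4)
    (h : CarriesToLinearOn n F ρ ψ a b V) (hV : IsOpen V)
    (hF : ContDiffOn ℝ ((n - 1 : ℕ) : WithTop ℕ∞) F V)
    (hρ : ContDiffOn ℝ n ρ V) (hψ : ContDiffOn ℝ n ψ V)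
    (hJ : ∀ p ∈ V, partialX ρ p * partialY ψ p - partialY ρ p * partialX ψ p ≠ 0)
    (hp : p ∈ V) : partialY F p = 0 := by
  have hρy : ∀ q ∈ V, partialY ρ q = 0 := by
    intro q hq
    rcases hn with rfl | rfl
    · exact h.partialY_fst_eq_zero_three hV hF hρ hψ hq (hJ q hq)
    · exact h.partialY_fst_eq_zero_four hV hF hρ hψ hq (hJ q hq)
  have hρx : ∀ q ∈ V, partialX ρ q ≠ 0 := by
    intro q hq h0
    exact hJ q hq (by rw [h0, hρy q hq]; ring)
  have hn1 : (1 : WithTop ℕ∞) ≤ n := by rcases hn with rfl | rfl <;> norm_num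
  have hn2 : (2 : WithTop ℕ∞) ≤ n := by rcases hn with rfl | rfl <;> norm_num
  have hfib : ∀ q ∈ V, ∀ᶠ q' in 𝓝 q, ρ q' = ρ (q'.1, q.2) := by
    intro q hq
    obtain ⟨ε, hε, hεV⟩ := Metric.isOpen_iff.mp hV q hq
    filter_upwards [Metric.ball_mem_nhds q hε] with q' hq'
    exact eq_of_mem_ball hV (hρ.of_le hn1) hεV (fun z hz => hρy z (hεV hz)) hq'
      (mk_mem_ball_iff.mpr ⟨(mk_mem_ball_iff.mp hq').1, Metric.mem_ball_self hε⟩)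
  have hψyy : ∀ q ∈ V, partialY (partialY ψ) q = 0 := by
    intro q hq
    rcases hn with rfl | rfl
    · exact h.partialY_partialY_snd_eq_zero_three hV hF hρ hψ hq (hfib q hq) (hρx q hq)
    · exact h.partialY_partialY_snd_eq_zero_four hV hF hρ hψ hq (hfib q hq) (hρx q hq)
  obtain ⟨ε, hε, hεV⟩ := Metric.isOpen_iff.mp hV p hp
  have H := fun y₁ y₂ => h.chainExpr_midpoint (y₁ := y₁) (y₂ := y₂)
    (by rcases hn with rfl | rfl <;> norm_num) hV hρ hψ hεV
    (fun _ _ _ => eq_of_mem_ball hV (hρ.of_le hn1) hεV fun z hz => hρy z (hεV hz))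
    (fun _ _ _ => midpoint_of_mem_ball hV (hψ.of_le hn2) hεV fun z hz => hψyy z (hεV hz))
    (hρx p hp)
  rcases hn with rfl | rfl
  · exact partialY_eq_zero_of_midpoint_three hε hV hεV hF H
  · exact partialY_eq_zero_of_midpoint_four hε hV hεV hF H

end nonlinear

/-! ### Linear equations and the converse -/

section linear
variable {F : ℝ × ℝ → ℝ} {V : Set (ℝ × ℝ)} {n : ℕ}

/-- The set `V` on which the transformation is defined may stick out of the domain `U` of `F`; the
argument takes place on `V ∩ U`. -/
theorem LinearizableOn.partialY_eq_zero (hn : n = 3 ∨ n = 4) {r : WithTop ℕ∞}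
    (hr : (n : WithTop ℕ∞) ≤ r) {U : Set (ℝ × ℝ)} (hU : IsOpen U)
    (hF : ContDiffOn ℝ ((n - 1 : ℕ) : WithTop ℕ∞) F U) (hV : IsOpen V)
    (h : LinearizableOn r n F V) {p : ℝ × ℝ} (hpU : p ∈ U) (hpV : p ∈ V) : partialY F p = 0 := by
  obtain ⟨ρ, ψ, a, b, ht, -, -, hc⟩ := h
  have hc' : CarriesToLinearOn n F ρ ψ a b (V ∩ U) :=
    fun x₀ y w hy hyV => hc x₀ y w hy hyV.1
  exact hc'.partialY_eq_zero hn (hV.inter hU) (hF.mono inter_subset_right)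
    ((ht.contDiffOn_fst.mono inter_subset_left).of_le hr)
    ((ht.contDiffOn_snd.mono inter_subset_left).of_le hr)
    (fun q hq => ht.jacobian_ne_zero q hq.1) ⟨hpV, hpU⟩

theorem ContDiffAt.iteratedDeriv_nat {f : ℝ → ℝ} {x : ℝ} {j k : ℕ}
    (hf : ContDiffAt ℝ (j + k : ℕ) f x) : ContDiffAt ℝ j (iteratedDeriv k f) x := by
  induction k generalizing j with
  | zero => simpa using hf
  | succ k ih =>
    rw [iteratedDeriv_succ]
    refine ContDiffAt.derivWithin (ih (j := j + 1) ?_) (by simp)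
    rwa [add_assoc, add_comm 1 k]

theorem ContDiffAt.continuousAt_iteratedDeriv {f : ℝ → ℝ} {x : ℝ} {m k : ℕ}
    (hf : ContDiffAt ℝ m f x) (hk : k ≤ m) : ContinuousAt (iteratedDeriv k f) x :=
  (ContDiffAt.iteratedDeriv_nat (j := 0)
    (hf.of_le (by rw [zero_add]; exact_mod_cast hk))).continuousAt

/-- If `F = f(x)`, then expanding `Ω^n` gives a linear operator in `y`, whose coefficients are
polynomials in `f, f', …, f⁽ⁿ⁻¹⁾` and hence continuous. -/
theorem isLinearOn_of_eq_fst (hn : n = 3 ∨ n = 4) (hV : IsOpen V)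
    (hF : ContDiffOn ℝ ((n - 1 : ℕ) : WithTop ℕ∞) F V) {f : ℝ → ℝ}
    (hf : ∀ q ∈ V, F q = f q.1) : IsLinearOn n F V := by
  have hfc : ∀ x ∈ Prod.fst '' V, ContDiffAt ℝ ((n - 1 : ℕ) : WithTop ℕ∞) f x := by
    rintro _ ⟨⟨x, y⟩, hp, rfl⟩
    refine (contDiffAt_along (y := fun _ => y) hF hV hp contDiffAt_const).congr_of_eventuallyEq ?_
    filter_upwards [eventually_graph_mem (y := fun _ => y) hV hp continuousAt_const] with t ht
    exact (hf _ ht).symm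
  have hfk : ∀ k ≤ n - 1, ContinuousOn (iteratedDeriv k f) (Prod.fst '' V) := fun k hk x hx =>
    ((hfc x hx).continuousAt_iteratedDeriv hk).continuousWithinAt
  have hFf : ∀ (x₀ : ℝ) (y : ℝ → ℝ), ContDiffAt ℝ n y x₀ → (x₀, y x₀) ∈ V →
      ∀ᶠ x in 𝓝 x₀, F (x, y x) = f x := by
    intro x₀ y hy hp
    filter_upwards [eventually_graph_mem hV hp hy.continuousAt] with x hx using hf _ hx
  rcases hn with rfl | rfl
  · have f0 := hfk 0 (by norm_num)
    have f1 := hfk 1 (by norm_num)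
    have f2 := hfk 2 (by norm_num)
    rw [iteratedDeriv_zero] at f0
    refine ⟨fun
      | 0 => fun x => iteratedDeriv 2 f x + 3 * f x * iteratedDeriv 1 f x + f x ^ 3
      | 1 => fun x => 3 * (iteratedDeriv 1 f x + f x ^ 2)
      | _ => fun x => 3 * f x, 0, ?_, continuousOn_const, ?_⟩
    · intro k hk
      interval_cases k <;> dsimp only <;> fun_prop
    · intro x₀ y hy hp
      rw [chainExpr_three (hFf x₀ y hy hp) (hfc _ (mem_image_of_mem _ hp)) hy, linearExpr]
      simp only [Finset.sum_range_succ, Finset.sum_range_zero, iteratedDeriv_zero, Pi.zero_apply]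
      ring
  · have f0 := hfk 0 (by norm_num)
    have f1 := hfk 1 (by norm_num)
    have f2 := hfk 2 (by norm_num)
    have f3 := hfk 3 (by norm_num)
    rw [iteratedDeriv_zero] at f0
    refine ⟨fun
      | 0 => fun x => iteratedDeriv 3 f x + 4 * f x * iteratedDeriv 2 f x
          + 3 * iteratedDeriv 1 f x ^ 2 + 6 * f x ^ 2 * iteratedDeriv 1 f x + f x ^ 4
      | 1 => fun x => 4 * (iteratedDeriv 2 f x + 3 * f x * iteratedDeriv 1 f x + f x ^ 3)
      | 2 => fun x => 6 * (iteratedDeriv 1 f x + f x ^ 2)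
      | _ => fun x => 4 * f x, 0, ?_, continuousOn_const, ?_⟩
    · intro k hk
      interval_cases k <;> dsimp only <;> fun_prop
    · intro x₀ y hy hp
      rw [chainExpr_four (hFf x₀ y hy hp) (hfc _ (mem_image_of_mem _ hp)) hy, linearExpr]
      simp only [Finset.sum_range_succ, Finset.sum_range_zero, iteratedDeriv_zero, Pi.zero_apply]
      ring

/-- A linear equation is linearized by the identity transformation. -/
theorem IsLinearOn.linearizableOn (h : IsLinearOn n F V) (r : WithTop ℕ∞) :
    LinearizableOn r n F V := by
  obtain ⟨a, b, ha, hb, h⟩ := h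
  refine ⟨Prod.fst, Prod.snd, a, b, ⟨contDiff_fst.contDiffOn, contDiff_snd.contDiffOn,
    fun p _ q _ hpq => hpq, fun p _ => ?_⟩, ha, hb, ?_⟩
  · simp [partialX, partialY]
  · intro x₀ y w hy hp _ _ hwy
    have hw : w =ᶠ[𝓝 x₀] y := hwy
    rw [h x₀ y hy hp]
    simp only [linearExpr, hw.iteratedDeriv_eq]

theorem exists_eq_fst_of_partialY_eq_zero (hV : IsOpen V) (hF : ContDiffOn ℝ 1 F V)
    (hc : ∀ x : ℝ, IsPreconnected {y : ℝ | (x, y) ∈ V}) (h0 : ∀ q ∈ V, partialY F q = 0) :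
    ∃ f : ℝ → ℝ, ∀ q ∈ V, F q = f q.1 := by
  classical
  refine ⟨fun x => if h : ∃ y, (x, y) ∈ V then F (x, h.choose) else 0, fun q hq => ?_⟩
  have h : ∃ y, (q.1, y) ∈ V := ⟨q.2, hq⟩
  simp only [h, dif_pos]
  exact eq_of_partialY_eq_zero hV hF (hV.preimage (by fun_prop : Continuous fun y => (q.1, y)))
    (hc q.1) (fun _ hy => hy) (fun _ hy => h0 _ hy) (show q.2 ∈ _ from hq) h.choose_spec

end linear

theorem mainTheorem2 (n : ℕ) (hn : n = 3 ∨ n = 4)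
    (r : WithTop ℕ∞) (hr : (n : WithTop ℕ∞) ≤ r)
    (U : Set (ℝ × ℝ)) (hU : IsOpen U)
    (F : ℝ × ℝ → ℝ) (hF : ContDiffOn ℝ ((n - 1 : ℕ) : WithTop ℕ∞) F U) :
    -- pointwise: linearizable near `p` iff `F = F(x)` near `p`, iff `F_y = 0` near `p`
    (∀ p ∈ U,
      (LinearizableNear r n F p ↔ ∃ f : ℝ → ℝ, ∀ᶠ q in 𝓝 p, F q = f q.1) ∧
      (LinearizableNear r n F p ↔ ∀ᶠ q in 𝓝 p, partialY F q = 0) ∧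
      -- in that case the equation is already linear
      (LinearizableNear r n F p → IsLinearNear n F p) ∧
      -- hence nonlinear equations are not linearizable
      (¬ IsLinearNear n F p → ¬ LinearizableNear r n F p)) ∧
    -- on the whole domain, with local point transformations
    ((∀ p ∈ U, LinearizableNear r n F p) ↔ ∀ p ∈ U, partialY F p = 0) ∧
    -- on the whole domain, with one point transformation
    ((∀ x : ℝ, IsPreconnected {y : ℝ | (x, y) ∈ U}) →
      (LinearizableOn r n F U ↔ ∃ f : ℝ → ℝ, ∀ q ∈ U, F q = f q.1) ∧
      ((∃ f : ℝ → ℝ, ∀ q ∈ U, F q = f q.1) → IsLinearOn n F U) ∧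
      (¬ IsLinearOn n F U → ¬ LinearizableOn r n F U)) := by
  have hF1 : ContDiffOn ℝ 1 F U := hF.of_le (by rcases hn with rfl | rfl <;> norm_num)
  have lin_dY : ∀ p ∈ U, LinearizableNear r n F p → ∀ᶠ q in 𝓝 p, partialY F q = 0 := by
    rintro p hp ⟨V, hV, hpV, h⟩
    filter_upwards [hV.mem_nhds hpV, hU.mem_nhds hp] with q hqV hqU
    exact h.partialY_eq_zero hn hr hU hF hV hqU hqV
  have dY_fst : ∀ p ∈ U, (∀ᶠ q in 𝓝 p, partialY F q = 0) →
      ∃ f : ℝ → ℝ, ∀ᶠ q in 𝓝 p, F q = f q.1 := by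
    intro p hp h
    obtain ⟨ε, hε, hεU⟩ := Metric.mem_nhds_iff.mp (inter_mem h (hU.mem_nhds hp))
    refine ⟨fun x => F (x, p.2), ?_⟩
    filter_upwards [Metric.ball_mem_nhds p hε] with q hq
    exact eq_of_mem_ball hU hF1 (fun z hz => (hεU hz).2) (fun z hz => (hεU hz).1) hq
      (mk_mem_ball_iff.mpr ⟨(mk_mem_ball_iff.mp hq).1, Metric.mem_ball_self hε⟩)
  have fst_lin : ∀ p ∈ U, (∃ f : ℝ → ℝ, ∀ᶠ q in 𝓝 p, F q = f q.1) → IsLinearNear n F p := by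
    rintro p hp ⟨f, hf⟩
    obtain ⟨V, hVs, hV, hpV⟩ := mem_nhds_iff.mp (inter_mem hf (hU.mem_nhds hp))
    exact ⟨V, hV, hpV, isLinearOn_of_eq_fst hn hV (hF.mono fun q hq => (hVs hq).2)
      fun q hq => (hVs hq).1⟩
  have lin_near : ∀ p, IsLinearNear n F p → LinearizableNear r n F p :=
    fun p ⟨V, hV, hpV, h⟩ => ⟨V, hV, hpV, h.linearizableOn r⟩
  refine ⟨fun p hp => ⟨⟨fun h => dY_fst p hp (lin_dY p hp h),
      fun h => lin_near p (fst_lin p hp h)⟩,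
    ⟨lin_dY p hp, fun h => lin_near p (fst_lin p hp (dY_fst p hp h))⟩,
    fun h => fst_lin p hp (dY_fst p hp (lin_dY p hp h)),
    fun hl h => hl (fst_lin p hp (dY_fst p hp (lin_dY p hp h)))⟩, ⟨?_, ?_⟩, fun hc => ?_⟩
  · exact fun h p hp => (lin_dY p hp (h p hp)).self_of_nhds
  · intro h p hp
    refine lin_near p (fst_lin p hp (dY_fst p hp ?_))
    filter_upwards [hU.mem_nhds hp] with q hq using h q hq
  · have on_fst : LinearizableOn r n F U → ∃ f : ℝ → ℝ, ∀ q ∈ U, F q = f q.1 := fun h =>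
      exists_eq_fst_of_partialY_eq_zero hU hF1 hc
        fun q hq => h.partialY_eq_zero hn hr hU hF hU hq hq
    have fst_on : (∃ f : ℝ → ℝ, ∀ q ∈ U, F q = f q.1) → IsLinearOn n F U := fun ⟨f, hf⟩ =>
      isLinearOn_of_eq_fst hn hU hF hf
    exact ⟨⟨on_fst, fun h => (fst_on h).linearizableOn r⟩, fst_on,
      fun hl h => hl (fst_on (on_fst h))⟩
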